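/- **The Hesse arrangement of conics.** For a finite non-empty set $Z\subset\mathbb P^2_{\mathbb C}$ put $$\varepsilon(\mathcal O_{\mathbb P^2}(1);Z)=\inf_{C}\frac{\deg C}{\sum_{p\in Z}\operatorname{mult}_p C},$$ the infimum being over all irreducible reduced plane curves $C$ meeting $Z$. For a finite arrangement $\mathcal C$ of plane curves let $\operatorname{Sing}(\mathcal C)$ be the set of singular points of the members and of points lying on at least two members, and put $$\varepsilon_{\mathcal C}(\mathcal O_{\mathbb P^2}(1))=\frac{\deg \mathcal C}{\sum_{p\in \operatorname{Sing}(\mathcal C)}\operatorname{mult}_p(\mathcal C)}.$$ Let $E\subset\mathbb P^2_{\mathbb C}$ be a smooth cubic that is not projectively equivalent to the Fermat cubic $x^3+y^3+z^3=0$. In the dual plane (identified with $\mathbb P^2_{\mathbb C}$ through the coefficients of lines) let $P$ be the set of points given by the inflectional tangents of $E$ (the cusps of the dual curve of $E$), let $\mathcal L$ be the set of lines dual to the flexes of $E$ (the dual Hesse arrangement), and let $\mathcal{CL}$ be the set of irreducible conics passing through exactly six points of $P$ (the Hesse, or Chilean, arrangement of conics). Then: 1. $\mathcal{CL}$ consists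 of exactly $12$ conics; they are smooth, all singular points of $\mathcal{CL}$ are ordinary (the curves through such a point are smooth there with pairwise distinct tangents), and no point lies on all $12$ conics. The set $P$ has exactly $9$ points, each of multiplicity $8$ in $\mathcal{CL}$; $\mathcal{CL}$ has exactly $12$ nodes (ordinary double points); and $Z:=\operatorname{Sing}(\mathcal{CL})$ is the union of $P$ and the set of nodes, so that $Z$ has $21$ points. Each conic contains exactly $6$ points of $P$ and exactly $2$ nodes. 2. $\mathcal L$ consists of exactly $9$ lines. $\operatorname{Sing}(\mathcal L)$ is the set of the $12$ nodes of $\mathcal{CL}$, and each of these is a triple point of $\mathcal L$. Each line of $\mathcal L$ contains exactly $4$ of the nodes and exactly one point of $P$. 3. There are three distinct lines of $\mathcal L$ and a conic of $\mathcal{CL}$ whose sum is a (reducible) quintic passing through all $21$ points of $Z$. 4. $\varepsilon_{\mathcal{CL}}(\mathcal O_{\mathbb P^2}(1))=\frac14$, and every conic $C\in\mathcal{CL}$ has $\deg C/\sum_{p\in Z}\operatorname{mult}_pC=\frac14$. 5. $\varepsilon(\mathcal O_{\mathbb P^2}(1);Z)=\frac15$, and the infimum is attained by every line of $\mathcal L$.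 In particular $\varepsilon(\mathcal O_{\mathbb P^2}(1);Z)<\varepsilon_{\mathcal{CL}}(\mathcal O_{\mathbb P^2}(1))$. -/

import Mathlib

open MvPolynomial
open scoped LinearAlgebra.Projectivization

/-- The complex projective plane.  The dual plane is identified with it through the coefficients of
lines: the point `q` of the dual plane is the line `∑ i, q i * x i = 0`. -/
abbrev Plane : Type := ℙ ℂ (Fin 3 → ℂ)

/-- A plane curve (effective divisor) of arbitrary degree `d`: a nonzero homogeneous form of degree
`d` in three variables, up to a nonzero scalar. -/
abbrev PlaneCurve : Type := Σ d : ℕ, ℙ ℂ (homogeneousSubmodule (Fin 3) ℂ d)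

namespace PlaneCurve

/-- The degree of a plane curve, which is also its intersection number with `O(1)`. -/
def degree (C : PlaneCurve) : ℕ := C.1

/-- An equation of a plane curve (well defined up to a nonzero scalar). -/
noncomputable def form (C : PlaneCurve) : MvPolynomial (Fin 3) ℂ := (C.2.rep).1

/-- The set of points of a plane curve. -/
def points (C : PlaneCurve) : Set Plane := {p | eval p.rep C.form = 0}

/-- The multiplicity of a curve at `p`: the least degree of a nonzero homogeneous component of the
Taylor expansion of its equation at `p`. -/
noncomputable def mult (C : PlaneCurve) (p : Plane) : ℕ :=
  sInf {n : ℕ | homogeneousComponent n (bind₁ (fun i => X i + MvPolynomial.C (p.rep i)) C.form) ≠ 0}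

/-- The gradient of the equation at `p`; where it is nonzero, its entries are the coefficients of
the tangent line at `p`. -/
noncomputable def grad (C : PlaneCurve) (p : Plane) : Fin 3 → ℂ :=
  fun i => eval p.rep (pderiv i C.form)

/-- Smoothness: every point of the curve has multiplicity one. -/
def IsSmooth (C : PlaneCurve) : Prop := ∀ p ∈ C.points, C.mult p = 1

/-- An irreducible and reduced curve. -/
def IsIntegral (C : PlaneCurve) : Prop := Irreducible C.form

/-- The flexes of a curve: its smooth points at which the tangent line meets the curve with
multiplicity at least three. -/
def flexes (C : PlaneCurve) : Set Plane :=
  {p | p ∈ C.points ∧ C.grad p ≠ 0 ∧ ∀ v : Fin 3 → ℂ, C.grad p ⬝ᵥ v = 0 →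
    (Polynomial.X : Polynomial ℂ) ^ 3 ∣
      aeval (fun i => Polynomial.C (p.rep i) + Polynomial.C (v i) * Polynomial.X) C.form}

/-- `C` is projectively equivalent to the Fermat cubic `x ^ 3 + y ^ 3 + z ^ 3 = 0`. -/
def IsFermatCubic (C : PlaneCurve) : Prop :=
  ∃ A : GL (Fin 3) ℂ, Associated C.form
    (bind₁ (fun i => ∑ j, MvPolynomial.C ((A : Matrix (Fin 3) (Fin 3) ℂ) i j) * X j)
      (X 0 ^ 3 + X 1 ^ 3 + X 2 ^ 3 : MvPolynomial (Fin 3) ℂ))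

/-- The ratio `L·C / ∑_{p ∈ Z} mult_p C` for `L = O(1)` and a finite set `Z` of points. -/
noncomputable def seshadriRatio (Z : Set Plane) (C : PlaneCurve) : ℝ :=
  (C.degree : ℝ) / ((∑ᶠ p ∈ Z, C.mult p : ℕ) : ℝ)

end PlaneCurve

/-- The multipoint Seshadri constant of `O(1)` on the plane at a finite set `Z` of points. -/
noncomputable def seshadriConstant (Z : Set Plane) : ℝ :=
  sInf {r : ℝ | ∃ C : PlaneCurve, C.IsIntegral ∧ (Z ∩ C.points).Nonempty ∧ r = C.seshadriRatio Z}

namespace Arrangement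

/-- The singular locus of an arrangement: the singular points of its members and the points where
at least two members intersect. -/
def sing (A : Set PlaneCurve) : Set Plane :=
  {p | (∃ C ∈ A, 2 ≤ C.mult p) ∨ ∃ C ∈ A, ∃ D ∈ A, C ≠ D ∧ p ∈ C.points ∧ p ∈ D.points}

/-- The multiplicity at `p` of the sum of all members of a finite arrangement. -/
noncomputable def mult (A : Set PlaneCurve) (p : Plane) : ℕ := ∑ᶠ C ∈ A, C.mult p

/-- All members through `p` are smooth there, with pairwise distinct tangent lines. -/
def IsOrdinaryAt (A : Set PlaneCurve) (p : Plane) : Prop :=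
  (∀ C ∈ A, p ∈ C.points → C.mult p = 1) ∧
  ∀ C ∈ A, ∀ D ∈ A, C ≠ D → p ∈ C.points → p ∈ D.points →
    LinearIndependent ℂ ![C.grad p, D.grad p]

/-- The nodes of an arrangement of smooth curves: its ordinary double points. -/
def nodes (A : Set PlaneCurve) : Set Plane :=
  {p | p ∈ sing A ∧ mult A p = 2 ∧ IsOrdinaryAt A p}

/-- A `d`-arrangement: at least three smooth curves of degree `d`, with only ordinary singular
points and without a point common to all of them. -/
def IsDArrangement (d : ℕ) (A : Set PlaneCurve) : Prop :=
  A.Finite ∧ 3 ≤ A.ncard ∧ (∀ C ∈ A, C.degree = d ∧ C.IsSmooth) ∧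
    (∀ p ∈ sing A, IsOrdinaryAt A p) ∧ ¬ ∃ p : Plane, ∀ C ∈ A, p ∈ C.points

/-- The configurational Seshadri constant: the degree of the arrangement divided by the sum of its
multiplicities over its singular locus. -/
noncomputable def configurationalSeshadri (A : Set PlaneCurve) : ℝ :=
  ((∑ᶠ C ∈ A, C.degree : ℕ) : ℝ) / ((∑ᶠ p ∈ sing A, mult A p : ℕ) : ℝ)

end Arrangement

/-- The points of the dual plane given by the inflectional tangents of a curve `E`.  For a smooth
cubic these are the cusps of the dual sextic. -/
def dualCusps (E : PlaneCurve) : Set Plane :=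
  {q | ∃ p ∈ E.flexes, ∃ h : E.grad p ≠ 0, q = Projectivization.mk ℂ (E.grad p) h}

/-- The Hesse arrangement of conics of a smooth cubic `E`: all irreducible conics in the dual plane
passing through exactly six of the cusps of the dual curve of `E`. -/
def hesseConics (E : PlaneCurve) : Set PlaneCurve :=
  {C | C.degree = 2 ∧ C.IsIntegral ∧ (dualCusps E ∩ C.points).ncard = 6}

/-- The dual Hesse arrangement of a smooth cubic `E`: the lines of the dual plane that are dual to
the flexes of `E` (the line dual to `p` consists of all lines through `p`). -/
def dualHesseLines (E : PlaneCurve) : Set PlaneCurve :=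
  {L | L.degree = 1 ∧ ∃ p ∈ E.flexes, L.points = {q : Plane | p.rep ⬝ᵥ q.rep = 0}}

/-
A smooth cubic `E` has a flex, because its Hessian meets it, and a flex brings `E` into Weierstrass
form. If `E` is not Fermat, a root of the three-division polynomial gives a flex off the axis of the
involution `y ↦ -y`; it is collinear with its mirror image and the flex at infinity, and the
three tangents form a triangle, which makes `E` the cubic `(x + y + z)³ + kxyz`. A discrete Fourier
transform turns this into `x³ + y³ + z³ = 3lxyz`, with `l ≠ 0` and `l³ ∉ {1, -8}`. Its nine flexes
are the points of the affine plane over `𝔽₃`; the twelve lines of that plane are the sides of the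
four inflection triangles, and a side `y₀` of the triangle `y₀y₁y₂` gives the conic `y₁y₂ = c y₀²`
in the dual plane. All incidences of the nine cusps and twelve nodes with the nine lines and twelve
conics are therefore those of `AG(2, 3)`.

Everything else follows from Bézout's theorem, which is elementary when one of the two curves has a
rational parametrization. Two members of an arrangement have no intersections besides the listed
ones, so there are no further singular points and all tangents are distinct; a conic through six
cusps shares five of them with one of the twelve, hence equals it. Three suitable lines and a conic
form a quintic through `Z`, so an integral curve `C` that is not one of its components has
`∑ mult_p C ≤ 5 deg C`; the components are checked directly.
-/

theorem height_eq_card_of_isMaximal {k σ : Type*} [Field k] [Finite σ]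
    (M : Ideal (MvPolynomial σ k)) [M.IsMaximal] : M.height = Nat.card σ := by
  induction σ using Finite.induction_empty_option with
  | @of_equiv α β e ih =>
    let e' := (renameEquiv k e).toRingEquiv
    have : (M.comap e').IsMaximal := Ideal.comap_isMaximal_of_equiv e'
    rw [← Nat.card_congr e, ← ih (M.comap e'), e'.height_comap]
  | h_empty =>
    have hle := M.height_le_ringKrullDim_of_ne_top (Ideal.IsMaximal.ne_top ‹_›)
    simpa using hle
  | @h_option α _ ih =>
    let e := (optionEquivLeft k α).toRingEquiv
    let P : Ideal (Polynomial (MvPolynomial α k)) := M.comap e.symm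
    have : P.IsMaximal := Ideal.comap_isMaximal_of_equiv e.symm
    have : (P.under (MvPolynomial α k)).IsMaximal :=
      Polynomial.isMaximal_comap_C_of_isJacobsonRing P
    have : P.LiesOver (P.under (MvPolynomial α k)) := ⟨rfl⟩
    rw [← e.symm.height_comap M, Polynomial.height_eq_height_add_one (P.under _) P, ih]
    simp

theorem exists_ne_zero_forall_eval_eq_zero {k σ : Type*} [Field k] [IsAlgClosed k] [Finite σ]
    (S : Finset (MvPolynomial σ k)) (hS : ∀ F ∈ S, eval 0 F = 0) (hcard : S.card < Nat.card σ) :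
    ∃ v : σ → k, v ≠ 0 ∧ ∀ F ∈ S, eval v F = 0 := by
  by_contra! hS'
  have hlocus : zeroLocus k (Ideal.span (S : Set (MvPolynomial σ k))) = {0} := by
    rw [zeroLocus_span]
    ext v
    simp only [Set.mem_ofPred_eq, Set.mem_singleton_iff, SetLike.mem_coe]
    refine ⟨fun h => by_contra fun hv => ?_, fun h F hF => h ▸ hS F hF⟩
    obtain ⟨F, hF, hne⟩ := hS' v hv
    exact hne (h F hF)
  let M : Ideal (MvPolynomial σ k) := (Ideal.span (S : Set (MvPolynomial σ k))).radical
  have hM : M.IsMaximal :=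
    isMaximal_iff_eq_vanishingIdeal_singleton.2 ⟨0, by
      rw [← hlocus, vanishingIdeal_zeroLocus_eq_radical]⟩
  have hmin : M ∈ (Ideal.span (S : Set (MvPolynomial σ k))).minimalPrimes :=
    ⟨⟨hM.isPrime, Ideal.le_radical⟩, fun J hJ _ => hJ.1.radical_le_iff.2 hJ.2⟩
  have hle := Ideal.height_le_card_of_mem_minimalPrimes_span S.finite_toSet hmin
  rw [height_eq_card_of_isMaximal, Set.ncard_coe_finset] at hle
  exact hcard.not_ge (by exact_mod_cast hle)

theorem dvd_of_forall_eval_eq_zero {k σ : Type*} [Field k] [IsAlgClosed k] [Finite σ]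
    {K F : MvPolynomial σ k} (hK : Irreducible K) (h : ∀ v, eval v K = 0 → eval v F = 0) :
    K ∣ F := by
  have hprime : (Ideal.span {K}).IsPrime :=
    (Ideal.span_singleton_prime hK.ne_zero).2 hK.prime
  rw [← Ideal.mem_span_singleton,
    ← MvPolynomial.IsPrime.vanishingIdeal_zeroLocus (K := k) (Ideal.span {K}),
    mem_vanishingIdeal_iff]
  intro v hv
  simp only [zeroLocus_span, Set.mem_singleton_iff, forall_eq, Set.mem_ofPred_eq] at hv
  exact h v hv

section Substitution

variable {R A σ τ υ : Type*} [CommRing R] [CommRing A] [Algebra R A]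

theorem derivation_aeval {M : Type*} [AddCommGroup M] [Module R M] [Module A M]
    [IsScalarTower R A M] [Fintype σ] (D : Derivation R A M) (g : σ → A) (F : MvPolynomial σ R) :
    D (aeval g F) = ∑ i, aeval g (pderiv i F) • D (g i) := by
  classical
  induction F using MvPolynomial.induction_on with
  | C a => simp
  | add p q hp hq => simp [hp, hq, add_smul, Finset.sum_add_distrib]
  | mul_X p i hp =>
    simp [Derivation.leibniz, pderiv_X, hp, Pi.single_apply, Finset.smul_sum, add_smul,
      Finset.sum_add_distrib, smul_smul, apply_ite (aeval g), ite_smul]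

theorem aeval_mul_of_isHomogeneous {F : MvPolynomial σ R} {d : ℕ} (hF : F.IsHomogeneous d)
    (c : A) (g : σ → A) : aeval (fun i => c * g i) F = c ^ d * aeval g F := by
  rw [aeval_def, aeval_def, eval₂_eq, eval₂_eq, Finset.mul_sum]
  refine Finset.sum_congr rfl fun m hm => ?_
  have hd : ∑ i ∈ m.support, m i = d := by
    rw [← hF (mem_support_iff.1 hm), Finsupp.weight_apply, Finsupp.sum]
    simp
  rw [Finset.prod_congr rfl fun i _ => mul_pow c (g i) (m i), Finset.prod_mul_distrib,
    Finset.prod_pow_eq_pow_sum, hd]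
  ring

theorem eval_smul_of_isHomogeneous {F : MvPolynomial σ R} {d : ℕ} (hF : F.IsHomogeneous d)
    (c : R) (v : σ → R) : eval (c • v) F = c ^ d * eval v F :=
  aeval_mul_of_isHomogeneous hF c v

/-- Linear substitution: the composite of a polynomial with the linear map given by a matrix. -/
noncomputable def linSubst [Fintype τ] (N : Matrix σ τ R) :
    MvPolynomial σ R →ₐ[R] MvPolynomial τ R :=
  bind₁ N.toMvPolynomial

theorem linSubst_X [Fintype τ] (N : Matrix σ τ R) (i : σ) :
    linSubst N (X i) = ∑ j, C (N i j) * X j := by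
  simp [linSubst, Matrix.toMvPolynomial, C_mul_X_eq_monomial]

theorem linSubst_one [Fintype σ] [DecidableEq σ] (F : MvPolynomial σ R) : linSubst 1 F = F := by
  simp [linSubst]

theorem linSubst_linSubst [Fintype τ] [Fintype υ] (N : Matrix σ τ R) (M : Matrix τ υ R)
    (F : MvPolynomial σ R) : linSubst M (linSubst N F) = linSubst (N * M) F := by
  rw [linSubst, linSubst, bind₁_bind₁, linSubst]
  simp_rw [← Matrix.toMvPolynomial_mul]

theorem eval_linSubst [Fintype τ] (N : Matrix σ τ R) (F : MvPolynomial σ R) (v : τ → R) :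
    eval v (linSubst N F) = eval (N.mulVec v) F := by
  rw [linSubst, ← coe_aeval_eq_eval, RingHom.coe_coe, aeval_bind₁]
  simp [Matrix.toMvPolynomial_eval_eq_apply]

theorem linSubst_isHomogeneous [Fintype τ] (N : Matrix σ τ R) {F : MvPolynomial σ R} {d : ℕ}
    (hF : F.IsHomogeneous d) : (linSubst N F).IsHomogeneous d := by
  simpa only [one_mul, linSubst, bind₁] using hF.aeval _ N.toMvPolynomial_isHomogeneous

theorem pderiv_linSubst [Fintype σ] [Fintype τ] (N : Matrix σ τ R) (F : MvPolynomial σ R) (j : τ) :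
    pderiv j (linSubst N F) = ∑ i, C (N i j) * linSubst N (pderiv i F) := by
  classical
  have hX : ∀ i, pderiv j (N.toMvPolynomial i) = C (N i j) := fun i => by
    simp [Matrix.toMvPolynomial, ← C_mul_X_eq_monomial, pderiv_X, Pi.single_apply]
  simp only [linSubst, bind₁, derivation_aeval, hX, smul_eq_mul, mul_comm]

/-- An invertible linear substitution, as an automorphism of the polynomial ring. -/
noncomputable def linSubstEquiv [Fintype σ] [DecidableEq σ] (N M : Matrix σ σ R) (h : M * N = 1) :
    MvPolynomial σ R ≃ₐ[R] MvPolynomial σ R :=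
  AlgEquiv.ofAlgHom (linSubst N) (linSubst M)
    (AlgHom.ext fun F => by simp [linSubst_linSubst, h, linSubst_one])
    (AlgHom.ext fun F => by simp [linSubst_linSubst, mul_eq_one_comm.1 h, linSubst_one])

end Substitution

section Order

variable {R A σ : Type*} [CommRing R] [CommRing A] [Algebra R A]

theorem pow_dvd_aeval_mul_of_homogeneousComponent_eq_zero {F : MvPolynomial σ R} {m : ℕ}
    (hF : ∀ k < m, homogeneousComponent k F = 0) (x : A) (g : σ → A) :
    x ^ m ∣ aeval (fun i => x * g i) F := by
  rw [← sum_homogeneousComponent F, map_sum]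
  refine Finset.dvd_sum fun k _ => ?_
  rcases lt_or_ge k m with hk | hk
  · simp [hF k hk]
  · rw [aeval_mul_of_isHomogeneous (homogeneousComponent_isHomogeneous k F)]
    exact (pow_dvd_pow x hk).mul_right _

/-- The Taylor expansion of `F` at `v`: the polynomial `F (X + v)`. -/
noncomputable def taylorAt (F : MvPolynomial σ R) (v : σ → R) : MvPolynomial σ R :=
  bind₁ (fun i => X i + C (v i)) F

/-- The order of vanishing of `F` at `v`: the least degree of a nonzero homogeneous component of
the Taylor expansion. It is `0` by convention when `F = 0`. -/
noncomputable def orderAt (F : MvPolynomial σ R) (v : σ → R) : ℕ :=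
  sInf {n | homogeneousComponent n (taylorAt F v) ≠ 0}

theorem aeval_taylorAt (F : MvPolynomial σ R) (v : σ → R) (g : σ → A) :
    aeval g (taylorAt F v) = aeval (fun i => g i + algebraMap R A (v i)) F := by
  simp [taylorAt, aeval_bind₁]

theorem taylorAt_ne_zero {F : MvPolynomial σ R} (hF : F ≠ 0) (v : σ → R) : taylorAt F v ≠ 0 := by
  intro h
  have hback := aeval_taylorAt F v (fun i => X i - C (v i))
  simp only [algebraMap_eq, sub_add_cancel, aeval_X_left_apply, h, map_zero] at hback
  exact hF hback.symm

theorem coeff_zero_taylorAt (F : MvPolynomial σ R) (v : σ → R) :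
    coeff 0 (taylorAt F v) = eval v F := by
  have h := aeval_taylorAt F v (0 : σ → R)
  simp only [aeval_zero, Algebra.algebraMap_self, RingHom.id_apply, Pi.zero_apply,
    zero_add] at h
  exact h

theorem pderiv_taylorAt (F : MvPolynomial σ R) (v : σ → R) (i : σ) :
    pderiv i (taylorAt F v) = taylorAt (pderiv i F) v := by
  classical
  unfold taylorAt
  induction F using MvPolynomial.induction_on with
  | C a => simp
  | add p q hp hq => simp only [map_add, hp, hq]
  | mul_X p j hp =>
    simp [pderiv_X, hp, Pi.single_apply, apply_ite (bind₁ _)]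

theorem orderAt_spec {F : MvPolynomial σ R} (hF : F ≠ 0) (v : σ → R) :
    homogeneousComponent (orderAt F v) (taylorAt F v) ≠ 0 := by
  refine Nat.sInf_mem (s := {n | homogeneousComponent n (taylorAt F v) ≠ 0}) ?_
  by_contra! hempty
  refine taylorAt_ne_zero hF v ?_
  rw [← sum_homogeneousComponent (taylorAt F v)]
  exact Finset.sum_eq_zero fun k _ => not_not.1 (Set.eq_empty_iff_forall_notMem.1 hempty k)

theorem homogeneousComponent_taylorAt_of_lt_orderAt {F : MvPolynomial σ R} {v : σ → R} {n : ℕ}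
    (hn : n < orderAt F v) : homogeneousComponent n (taylorAt F v) = 0 :=
  not_not.1 (Nat.notMem_of_lt_sInf hn)

theorem orderAt_eq_zero_iff {F : MvPolynomial σ R} (hF : F ≠ 0) {v : σ → R} :
    orderAt F v = 0 ↔ eval v F ≠ 0 := by
  have hzero : homogeneousComponent 0 (taylorAt F v) = 0 ↔ eval v F = 0 := by
    rw [homogeneousComponent_zero, coeff_zero_taylorAt, C_eq_zero]
  refine ⟨fun h h0 => orderAt_spec hF v (by rwa [h, hzero]), fun h => Nat.sInf_eq_zero.2 (.inl ?_)⟩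
  exact fun h0 => h (hzero.1 h0)

theorem homogeneousComponent_one_eq_zero_iff {F : MvPolynomial σ R} :
    homogeneousComponent 1 F = 0 ↔ ∀ i, coeff 0 (pderiv i F) = 0 := by
  classical
  have hcoeff : ∀ i, coeff 0 (pderiv i F) = coeff (Finsupp.single i 1) F := fun i => by
    simp [coeff_pderiv]
  simp only [hcoeff, MvPolynomial.ext_iff, coeff_homogeneousComponent, coeff_zero]
  constructor
  · intro h i
    simpa using h (Finsupp.single i 1)
  · intro h m
    split_ifs with hm
    · obtain ⟨i, rfl⟩ := (Finsupp.sum_eq_one_iff m).1 hm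
      exact h i
    · rfl

theorem orderAt_eq_one_iff {F : MvPolynomial σ R} (hF : F ≠ 0) {v : σ → R} :
    orderAt F v = 1 ↔ eval v F = 0 ∧ ∃ i, eval v (pderiv i F) ≠ 0 := by
  have hone : homogeneousComponent 1 (taylorAt F v) = 0 ↔ ∀ i, eval v (pderiv i F) = 0 := by
    simp only [homogeneousComponent_one_eq_zero_iff, pderiv_taylorAt, coeff_zero_taylorAt]
  have hzero := orderAt_eq_zero_iff hF (v := v)
  constructor
  · intro h
    refine ⟨not_not.1 fun h0 => by simp [hzero.2 h0] at h, ?_⟩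
    by_contra! hall
    exact orderAt_spec hF v (by rw [h, hone]; exact hall)
  · rintro ⟨h0, i, hi⟩
    refine le_antisymm (Nat.sInf_le fun h => hi (hone.1 h i)) ?_
    exact Nat.one_le_iff_ne_zero.2 fun h => hzero.1 h h0

theorem pow_orderAt_dvd_aeval (F : MvPolynomial σ R) (v : σ → R) {x : A} {g : σ → A}
    (hg : ∀ i, x ∣ g i - algebraMap R A (v i)) : x ^ orderAt F v ∣ aeval g F := by
  choose h hh using hg
  have hsum : g = fun i => x * h i + algebraMap R A (v i) := by
    funext i
    rw [← hh, sub_add_cancel]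
  rw [hsum, ← aeval_taylorAt F v (fun i => x * h i)]
  exact pow_dvd_aeval_mul_of_homogeneousComponent_eq_zero
    (fun _ => homogeneousComponent_taylorAt_of_lt_orderAt) x h

end Order

section Bezout

variable {k σ : Type*} [Field k]

theorem eval_aeval_polynomial {R : Type*} [CommRing R] (g : σ → Polynomial R)
    (F : MvPolynomial σ R) (t : R) :
    (aeval g F).eval t = eval (fun i => (g i).eval t) F := by
  rw [← Polynomial.coe_aeval_eq_eval, comp_aeval_apply]
  rfl

theorem exists_forall_sub_mul_ne_zero [Infinite k] {ι : Type*} (S : Finset ι) {w : ι → Fin 2 → k}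
    (hw : ∀ p ∈ S, w p ≠ 0) : ∃ x : k, ∀ p ∈ S, w p 0 - x * w p 1 ≠ 0 := by
  classical
  obtain ⟨x, hx⟩ := Infinite.exists_notMem_finset (S.image fun p => w p 0 / w p 1)
  refine ⟨x, fun p hp h => ?_⟩
  by_cases h1 : w p 1 = 0
  · exact hw p hp (funext (Fin.forall_fin_two.2 ⟨by simpa [h1] using h, h1⟩))
  · exact hx (Finset.mem_image.2 ⟨p, hp, by rw [div_eq_iff h1, sub_eq_zero.1 h]⟩)

/-- Restriction of binary forms to the affine line of parameters `(1 + x * t, t)`, which misses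
only the projective parameter `(x : 1)`. -/
noncomputable def dehomogenize (x : k) : MvPolynomial (Fin 2) k →ₐ[k] Polynomial k :=
  aeval ![1 + Polynomial.C x * Polynomial.X, Polynomial.X]

theorem eval_eq_pow_mul_eval_dehomogenize {x : k} {G : MvPolynomial (Fin 2) k} {n : ℕ}
    (hG : G.IsHomogeneous n) {v : Fin 2 → k} (hv : v 0 - x * v 1 ≠ 0) :
    eval v G =
      (v 0 - x * v 1) ^ n * (dehomogenize x G).eval (v 1 / (v 0 - x * v 1)) := by
  rw [dehomogenize, eval_aeval_polynomial, ← eval_smul_of_isHomogeneous hG]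
  congr 2
  funext i
  fin_cases i
  · simp only [Fin.zero_eta, Pi.smul_apply, Matrix.cons_val_zero, Polynomial.eval_add,
      Polynomial.eval_mul, Polynomial.eval_one, Polynomial.eval_C, Polynomial.eval_X, smul_eq_mul]
    field_simp
    ring
  · simp [mul_div_cancel₀ _ hv]

theorem dehomogenize_ne_zero [Infinite k] (x : k) {G : MvPolynomial (Fin 2) k} {n : ℕ}
    (hG : G.IsHomogeneous n) (h0 : G ≠ 0) : dehomogenize x G ≠ 0 := by
  intro h
  have hprod : G * (X 0 - C x * X 1) = 0 := by
    refine MvPolynomial.funext fun v => ?_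
    by_cases hv : v 0 - x * v 1 = 0
    · simp [hv]
    · simp [eval_eq_pow_mul_eval_dehomogenize hG hv, h]
  have hlin : (X 0 - C x * X 1 : MvPolynomial (Fin 2) k) ≠ 0 := fun h =>
    by simpa using congrArg (eval ![1, 0]) h
  exact mul_ne_zero h0 hlin hprod

theorem natDegree_dehomogenize_le (x : k) {G : MvPolynomial (Fin 2) k} {n : ℕ}
    (hG : G.IsHomogeneous n) : (dehomogenize x G).natDegree ≤ n := by
  refine (aeval_natDegree_le _ hG.totalDegree_le _ (n := 1) fun i => ?_).trans (by simp)
  fin_cases i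
  · change (1 + Polynomial.C x * Polynomial.X).natDegree ≤ 1
    compute_degree
  · exact Polynomial.natDegree_X_le

/-- The zeros of the irreducible form `K` are the values, up to scalars, of a tuple `φ` of binary
forms of degree `e`. -/
structure IsParametrization (K : MvPolynomial σ k) (e : ℕ) (φ : σ → MvPolynomial (Fin 2) k) :
    Prop where
  irreducible : Irreducible K
  pos : 0 < e
  isHomogeneous : ∀ i, (φ i).IsHomogeneous e
  bind_eq_zero : bind₁ φ K = 0
  surj : ∀ v, eval v K = 0 → ∃ (c : k) (w : Fin 2 → k), v = c • fun i => eval w (φ i)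

/-- `F` vanishes to order at least `m` along every polynomial arc on the zero set of `K` through a
multiple of `v`: a lower bound for the intersection multiplicity of `K` and `F` at `v` which needs
no local rings. -/
def HasContact (K F : MvPolynomial σ k) (v : σ → k) (m : ℕ) : Prop :=
  ∀ (g : σ → Polynomial k) (t c : k), c ≠ 0 → (∀ i, (g i).eval t = c * v i) → aeval g K = 0 →
    (Polynomial.X - Polynomial.C t) ^ m ∣ aeval g F

theorem hasContact_orderAt (K : MvPolynomial σ k) {F : MvPolynomial σ k} {d : ℕ}
    (hF : F.IsHomogeneous d) (v : σ → k) : HasContact K F v (orderAt F v) := by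
  intro g t c hc hg _
  have hscale : g = fun i => Polynomial.C c * (Polynomial.C c⁻¹ * g i) := by
    funext i
    rw [← mul_assoc, ← Polynomial.C_mul, mul_inv_cancel₀ hc, Polynomial.C_1, one_mul]
  rw [hscale, aeval_mul_of_isHomogeneous hF]
  refine (pow_orderAt_dvd_aeval F v fun i => ?_).mul_left _
  rw [Polynomial.dvd_iff_isRoot]
  simp [hg, hc]

theorem hasContact_one_of_eval_eq_zero (K : MvPolynomial σ k) {F : MvPolynomial σ k} {d : ℕ}
    (hF : F.IsHomogeneous d) {v : σ → k} (hv : eval v F = 0) : HasContact K F v 1 := by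
  intro g t c _ hg _
  rw [pow_one, Polynomial.dvd_iff_isRoot, Polynomial.IsRoot, eval_aeval_polynomial,
    show (fun i => (g i).eval t) = c • v from funext hg, eval_smul_of_isHomogeneous hF, hv,
    mul_zero]

theorem eval_derivative_aeval [Fintype σ] {F : MvPolynomial σ k} {d : ℕ} (hF : F.IsHomogeneous d)
    {g : σ → Polynomial k} {t c : k} {v : σ → k} (hg : ∀ i, (g i).eval t = c * v i) :
    (Polynomial.derivative (aeval g F)).eval t = c ^ (d - 1) *
      ((fun i => eval v (pderiv i F)) ⬝ᵥ fun i => (Polynomial.derivative (g i)).eval t) := by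
  have hchain := derivation_aeval (Polynomial.derivative' (R := k)) g F
  simp only [Polynomial.derivative'_apply, smul_eq_mul] at hchain
  rw [hchain, Polynomial.eval_finsetSum, dotProduct, Finset.mul_sum]
  refine Finset.sum_congr rfl fun i _ => ?_
  rw [Polynomial.eval_mul, eval_aeval_polynomial,
    show (fun i => (g i).eval t) = c • v from funext hg, eval_smul_of_isHomogeneous hF.pderiv,
    mul_assoc]

theorem hasContact_two_of_smul_eq [Finite σ] {K F : MvPolynomial σ k} {d e : ℕ}
    (hK : K.IsHomogeneous e) (hF : F.IsHomogeneous d) {v : σ → k} (hv : eval v F = 0) {a : k}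
    (ha : ∀ i, a * eval v (pderiv i K) = eval v (pderiv i F)) : HasContact K F v 2 := by
  have := Fintype.ofFinite σ
  intro g t c hc hg hgK
  obtain ⟨Q, hQ⟩ := hasContact_one_of_eval_eq_zero K hF hv g t c hc hg hgK
  have hderK : (fun i => eval v (pderiv i K)) ⬝ᵥ
      (fun i => (Polynomial.derivative (g i)).eval t) = 0 := by
    simpa [hgK, hc] using (eval_derivative_aeval hK hg).symm
  have hderF : (Polynomial.derivative (aeval g F)).eval t = 0 := by
    have hgrad : (fun i => eval v (pderiv i F)) = a • fun i => eval v (pderiv i K) := by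
      funext i
      rw [Pi.smul_apply, smul_eq_mul, ha]
    rw [eval_derivative_aeval hF hg, hgrad, smul_dotProduct, hderK, smul_zero, mul_zero]
  rw [pow_one] at hQ
  rw [hQ, pow_two]
  refine mul_dvd_mul_left _ (Polynomial.dvd_iff_isRoot.2 ?_)
  simpa [hQ, Polynomial.derivative_mul] using hderF

namespace IsParametrization

variable {K : MvPolynomial σ k} {e : ℕ} {φ : σ → MvPolynomial (Fin 2) k}

theorem bind₁_ne_zero [IsAlgClosed k] [Finite σ] (hK : IsParametrization K e φ)
    {F : MvPolynomial σ k} {d : ℕ} (hF : F.IsHomogeneous d) (hKF : ¬ K ∣ F) : bind₁ φ F ≠ 0 := by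
  refine fun h0 => hKF (dvd_of_forall_eval_eq_zero hK.irreducible fun v hv => ?_)
  obtain ⟨c, w, rfl⟩ := hK.surj v hv
  have heval : eval (fun i => eval w (φ i)) F = eval w (bind₁ φ F) := by
    simp only [← coe_aeval_eq_eval, RingHom.coe_coe, aeval_bind₁]
  rw [eval_smul_of_isHomogeneous hF, heval, h0, map_zero, mul_zero]

/-- A single affine chart of the parameter line reaches all the points of a finite set. -/
theorem exists_aeval_eq_zero_and_eval_eq [IsAlgClosed k] [Finite σ] (hK : IsParametrization K e φ)
    (S : Finset (ℙ k (σ → k))) (hS : ∀ p ∈ S, eval p.rep K = 0) :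
    ∃ g : σ → Polynomial k, aeval g K = 0 ∧
      (∀ p ∈ S, ∃ t c : k, c ≠ 0 ∧ ∀ i, (g i).eval t = c * p.rep i) ∧
      ∀ (F : MvPolynomial σ k) (d : ℕ), F.IsHomogeneous d → ¬ K ∣ F →
        aeval g F ≠ 0 ∧ (aeval g F).natDegree ≤ e * d := by
  have hparam : ∀ p : ℙ k (σ → k), ∃ (c : k) (w : Fin 2 → k),
      p ∈ S → p.rep = c • fun i => eval w (φ i) := fun p => by
    by_cases hp : p ∈ S
    · obtain ⟨c, w, h⟩ := hK.surj _ (hS p hp)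
      exact ⟨c, w, fun _ => h⟩
    · exact ⟨0, 0, fun h => absurd h hp⟩
  choose c w hw using hparam
  have hc : ∀ p ∈ S, c p ≠ 0 := fun p hp h0 => p.rep_nonzero (by rw [hw p hp, h0, zero_smul])
  have hw0 : ∀ p ∈ S, w p ≠ 0 := fun p hp h0 => p.rep_nonzero <| by
    rw [hw p hp, h0]
    funext i
    have hzero := eval_smul_of_isHomogeneous (hK.isHomogeneous i) 0 0
    rw [zero_smul, zero_pow hK.pos.ne', zero_mul] at hzero
    simp only [Pi.smul_apply, hzero, smul_zero, Pi.zero_apply]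
  obtain ⟨x, hx⟩ := exists_forall_sub_mul_ne_zero S hw0
  have hcomp : ∀ F, aeval (fun i => dehomogenize x (φ i)) F = dehomogenize x (bind₁ φ F) :=
    fun F => by rw [dehomogenize, aeval_bind₁]
  refine ⟨fun i => dehomogenize x (φ i), ?_, fun p hp => ?_, fun F d hF hKF => ?_⟩
  · rw [hcomp, hK.bind_eq_zero, map_zero]
  · have hscale : (w p 0 - x * w p 1) ^ e * c p ≠ 0 :=
      mul_ne_zero (pow_ne_zero _ (hx p hp)) (hc p hp)
    refine ⟨w p 1 / (w p 0 - x * w p 1), _, inv_ne_zero hscale, fun i => ?_⟩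
    rw [hw p hp, Pi.smul_apply, smul_eq_mul,
      eval_eq_pow_mul_eval_dehomogenize (hK.isHomogeneous i) (hx p hp), ← mul_assoc (c p),
      mul_comm (c p), inv_mul_cancel_left₀ hscale]
  · have hhom : (bind₁ φ F).IsHomogeneous (e * d) := hF.aeval φ hK.isHomogeneous
    rw [hcomp]
    exact ⟨dehomogenize_ne_zero x hhom (hK.bind₁_ne_zero hF hKF), natDegree_dehomogenize_le x hhom⟩

/-- Bézout's theorem for a parametrized hypersurface `K` and a form `F`. -/
theorem sum_le_of_hasContact [IsAlgClosed k] [Finite σ] (hK : IsParametrization K e φ)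
    {F : MvPolynomial σ k} {d : ℕ} (hF : F.IsHomogeneous d) (hKF : ¬ K ∣ F)
    (S : Finset (ℙ k (σ → k))) (hS : ∀ p ∈ S, eval p.rep K = 0) (m : ℙ k (σ → k) → ℕ)
    (hm : ∀ p ∈ S, HasContact K F p.rep (m p)) : ∑ p ∈ S, m p ≤ e * d := by
  obtain ⟨g, hgK, hgS, hgF⟩ := hK.exists_aeval_eq_zero_and_eval_eq S hS
  obtain ⟨hne, hdeg⟩ := hgF F d hF hKF
  have hparam : ∀ p : ℙ k (σ → k), ∃ t c : k, p ∈ S → c ≠ 0 ∧ ∀ i, (g i).eval t = c * p.rep i :=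
    fun p => by
      by_cases hp : p ∈ S
      · obtain ⟨t, c, h⟩ := hgS p hp
        exact ⟨t, c, fun _ => h⟩
      · exact ⟨0, 0, fun h => absurd h hp⟩
  choose t c ht using hparam
  have hinj : Set.InjOn t S := fun p hp q hq hpq => by
    rw [← p.mk_rep, ← q.mk_rep, Projectivization.mk_eq_mk_iff']
    refine ⟨(c p)⁻¹ * c q, funext fun i => ?_⟩
    rw [Pi.smul_apply, smul_eq_mul, mul_assoc, ← (ht q hq).2, ← hpq, (ht p hp).2,
      inv_mul_cancel_left₀ (ht p hp).1]
  have hdvd : ∏ p ∈ S, (Polynomial.X - Polynomial.C (t p)) ^ m p ∣ aeval g F := by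
    refine Finset.prod_dvd_of_coprime (fun p hp q hq hpq => ?_) fun p hp =>
      hm p hp g _ _ (ht p hp).1 (ht p hp).2 hgK
    exact (Polynomial.isCoprime_X_sub_C_of_isUnit_sub
      (sub_ne_zero.2 (hinj.ne hp hq hpq)).isUnit).pow
  have hle := Polynomial.natDegree_le_of_dvd hdvd hne
  rw [Polynomial.natDegree_prod _ _ fun p _ => pow_ne_zero _ (Polynomial.X_sub_C_ne_zero _)] at hle
  simpa using hle.trans hdeg

theorem linSubst [Fintype σ] [DecidableEq σ] (hK : IsParametrization K e φ) {N M : Matrix σ σ k}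
    (h : M * N = 1) :
    IsParametrization (linSubst N K) e (fun i => bind₁ φ (M.toMvPolynomial i)) where
  irreducible := (MulEquiv.irreducible_iff (linSubstEquiv N M h)).2 hK.irreducible
  pos := hK.pos
  isHomogeneous i := by
    simpa only [bind₁, mul_one] using (M.toMvPolynomial_isHomogeneous i).aeval φ hK.isHomogeneous
  bind_eq_zero := by
    rw [← bind₁_bind₁]
    change bind₁ φ (_root_.linSubst M (_root_.linSubst N K)) = 0
    rw [linSubst_linSubst, mul_eq_one_comm.1 h, linSubst_one, hK.bind_eq_zero]
  surj v hv := by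
    rw [eval_linSubst] at hv
    obtain ⟨c, w, hw⟩ := hK.surj _ hv
    refine ⟨c, w, ?_⟩
    have hv' : v = M.mulVec (N.mulVec v) := by rw [Matrix.mulVec_mulVec, h, Matrix.one_mulVec]
    rw [hv', hw, Matrix.mulVec_smul]
    congr 1
    funext i
    rw [← Matrix.toMvPolynomial_eval_eq_apply]
    simp only [← coe_aeval_eq_eval, RingHom.coe_coe, aeval_bind₁]

theorem C_mul (hK : IsParametrization K e φ) {c : k} (hc : c ≠ 0) :
    IsParametrization (C c * K) e φ where
  irreducible := (irreducible_isUnit_mul ((isUnit_iff_ne_zero.2 hc).map C)).2 hK.irreducible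
  pos := hK.pos
  isHomogeneous := hK.isHomogeneous
  bind_eq_zero := by rw [map_mul, hK.bind_eq_zero, mul_zero]
  surj v hv := hK.surj v (by simpa [hc] using hv)

end IsParametrization

theorem isParametrization_line : IsParametrization (X 0 : MvPolynomial (Fin 3) k) 1
    ![0, X 0, X 1] where
  irreducible := X_prime.irreducible
  pos := one_pos
  isHomogeneous i := by
    fin_cases i
    · exact isHomogeneous_zero _ _ _
    · exact isHomogeneous_X _ _
    · exact isHomogeneous_X _ _
  bind_eq_zero := by simp
  surj v hv := by
    refine ⟨1, ![v 1, v 2], funext fun i => ?_⟩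
    rw [eval_X] at hv
    fin_cases i <;> simp [hv]

theorem irreducible_X_mul_X_sub_X_sq :
    Irreducible (X 1 * X 2 - X 0 ^ 2 : MvPolynomial (Fin 3) k) := by
  have hirr := irreducible_mul_X_add (X 1 : MvPolynomial (Fin 3) k) (-X 0 ^ 2) 2 (X_ne_zero _)
    (by simp) ?_ ?_
  · rwa [← sub_eq_add_neg] at hirr
  · rw [vars_neg]
    exact fun h => by simpa using vars_pow _ _ h
  · have hprime : Prime (X 1 : MvPolynomial (Fin 3) k) := X_prime
    rw [IsRelPrime.neg_right_iff, hprime.irreducible.isRelPrime_iff_not_dvd]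
    intro h
    simpa using (X_dvd_X).1 (hprime.dvd_of_dvd_pow h)

theorem isParametrization_conic :
    IsParametrization (X 1 * X 2 - X 0 ^ 2 : MvPolynomial (Fin 3) k) 2
      ![X 0 * X 1, X 0 ^ 2, X 1 ^ 2] where
  irreducible := irreducible_X_mul_X_sub_X_sq
  pos := two_pos
  isHomogeneous i := by
    fin_cases i
    · exact (isHomogeneous_X _ _).mul (isHomogeneous_X _ _)
    · exact isHomogeneous_X_pow _ _
    · exact isHomogeneous_X_pow _ _
  bind_eq_zero := by
    simp only [map_sub, map_mul, map_pow, bind₁_X_right]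
    simp only [Matrix.cons_val_one, Matrix.cons_val_zero, Matrix.cons_val]
    ring
  surj v hv := by
    simp only [map_sub, map_mul, map_pow, eval_X] at hv
    by_cases h2 : v 2 = 0
    · have h0 : v 0 = 0 := by simpa [h2] using hv
      refine ⟨v 1, ![1, 0], funext fun i => ?_⟩
      fin_cases i <;> simp [h0, h2]
    · refine ⟨(v 2)⁻¹, ![v 0, v 2], funext fun i => ?_⟩
      fin_cases i
      · simp only [Fin.zero_eta, Pi.smul_apply, Matrix.cons_val_zero, map_mul, eval_X,
          Matrix.cons_val_one, smul_eq_mul]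
        field_simp
      · simp only [Fin.mk_one, Pi.smul_apply, Matrix.cons_val_one, Matrix.cons_val_zero, map_pow,
          eval_X, smul_eq_mul]
        field_simp
        linear_combination hv
      · simp only [Fin.reduceFinMk, Pi.smul_apply, Matrix.cons_val, map_pow, eval_X, smul_eq_mul]
        field_simp

end Bezout

section Nonsingular

variable {k σ : Type*} [Field k]

/-- A form whose projective zero set has no singular points. -/
def IsNonsingularForm (F : MvPolynomial σ k) : Prop :=
  ∀ v : σ → k, v ≠ 0 → eval v F = 0 → ∃ i, eval v (pderiv i F) ≠ 0

theorem eval_pderiv_linSubst [Fintype σ] (N : Matrix σ σ k) (F : MvPolynomial σ k) (v : σ → k) :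
    (fun j => eval v (pderiv j (linSubst N F))) =
      N.transpose.mulVec fun i => eval (N.mulVec v) (pderiv i F) := by
  funext j
  simp [pderiv_linSubst, eval_linSubst, Matrix.mulVec, dotProduct]

theorem mulVec_ne_zero_of_mul_eq_one [Fintype σ] [DecidableEq σ] {M N : Matrix σ σ k}
    (h : M * N = 1) {v : σ → k} (hv : v ≠ 0) : N.mulVec v ≠ 0 := fun h0 => hv <| by
  rw [← Matrix.one_mulVec v, ← h, ← Matrix.mulVec_mulVec, h0, Matrix.mulVec_zero]

theorem transpose_mul_transpose_eq_one {R : Type*} [CommRing R] [Fintype σ] [DecidableEq σ]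
    {M N : Matrix σ σ R} (h : M * N = 1) : M.transpose * N.transpose = 1 := by
  rw [← Matrix.transpose_mul, mul_eq_one_comm.1 h, Matrix.transpose_one]

namespace IsNonsingularForm

variable {F : MvPolynomial σ k}

theorem linSubst [Fintype σ] [DecidableEq σ] (hF : IsNonsingularForm F) {M N : Matrix σ σ k}
    (h : M * N = 1) : IsNonsingularForm (linSubst N F) := by
  intro v hv h0
  rw [eval_linSubst] at h0
  obtain ⟨i, hi⟩ := hF _ (mulVec_ne_zero_of_mul_eq_one h hv) h0
  have hgrad := mulVec_ne_zero_of_mul_eq_one (transpose_mul_transpose_eq_one h)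
    (v := fun i => eval (N.mulVec v) (pderiv i F)) (fun h0 => hi (congrFun h0 i))
  rw [← eval_pderiv_linSubst] at hgrad
  exact Function.ne_iff.1 hgrad

theorem C_mul (hF : IsNonsingularForm F) {c : k} (hc : c ≠ 0) : IsNonsingularForm (C c * F) := by
  intro v hv h0
  obtain ⟨i, hi⟩ := hF v hv (by simpa [hc] using h0)
  exact ⟨i, by simp [hc, hi]⟩

end IsNonsingularForm

theorem isNonsingularForm_X (i : σ) : IsNonsingularForm (X i : MvPolynomial σ k) :=
  fun _ _ _ => ⟨i, by simp⟩

theorem isNonsingularForm_conic :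
    IsNonsingularForm (X 1 * X 2 - X 0 ^ 2 : MvPolynomial (Fin 3) k) := by
  intro v hv h
  by_contra! hgrad
  have h1 : v 2 = 0 := by simpa [pderiv_X] using hgrad 1
  have h2 : v 1 = 0 := by simpa [pderiv_X] using hgrad 2
  have h0 : v 0 = 0 := by simpa [h1] using h
  exact hv (funext (Fin.forall_fin_succ.2 ⟨h0, Fin.forall_fin_two.2 ⟨h2, h1⟩⟩))

end Nonsingular

section LinearForm

/-- The linear form with given coefficients. -/
noncomputable def linearForm {R σ : Type*} [CommSemiring R] [Fintype σ] (f : σ → R) :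
    MvPolynomial σ R :=
  ∑ i, C (f i) * X i

theorem eval_linearForm {R σ : Type*} [CommSemiring R] [Fintype σ] (f v : σ → R) :
    eval v (linearForm f) = f ⬝ᵥ v := by
  simp [linearForm, dotProduct]

theorem linearForm_ne_zero {R σ : Type*} [CommSemiring R] [Fintype σ] {f : σ → R} (hf : f ≠ 0) :
    linearForm f ≠ 0 := fun h => hf <| dotProduct_eq_zero f fun v => by
  rw [← eval_linearForm, h, map_zero]

theorem linearForm_isHomogeneous {R σ : Type*} [CommSemiring R] [Fintype σ] (f : σ → R) :
    (linearForm f).IsHomogeneous 1 :=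
  IsHomogeneous.sum _ _ 1 fun _ _ => isHomogeneous_C_mul_X _ _

theorem exists_mul_eq_one_and_row_eq {k ι : Type*} [Field k] [Fintype ι] [DecidableEq ι] (i : ι)
    {f : ι → k} (hf : f ≠ 0) : ∃ N M : Matrix ι ι k, M * N = 1 ∧ N i = f := by
  have hi : (Pi.single i 1 : ι → k) ≠ 0 := by simp
  obtain ⟨A, hA⟩ := Submodule.exists_linearEquiv_restrict_eq
    ((LinearEquiv.toSpanNonzeroSingleton k (ι → k) _ hi).symm ≪≫ₗ
      LinearEquiv.toSpanNonzeroSingleton k (ι → k) f hf)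
  have hAi : A (Pi.single i 1) = f := by
    rw [← hA ⟨_, Submodule.mem_span_singleton_self _⟩, LinearEquiv.trans_apply,
      LinearEquiv.coord_self, LinearEquiv.toSpanNonzeroSingleton_apply]
    exact one_smul k f
  refine ⟨(LinearMap.toMatrix' (A : (ι → k) →ₗ[k] ι → k)).transpose,
    (LinearMap.toMatrix' (A.symm : (ι → k) →ₗ[k] ι → k)).transpose, ?_, ?_⟩
  · rw [← Matrix.transpose_mul, ← LinearMap.toMatrix'_comp]
    simp
  · rw [← hAi]
    funext j
    simp [LinearMap.toMatrix'_apply]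

theorem exists_linearForm_eq_linSubst {k ι : Type*} [Field k] [Fintype ι] [DecidableEq ι] (i : ι)
    {f : ι → k} (hf : f ≠ 0) :
    ∃ N M : Matrix ι ι k, M * N = 1 ∧ linearForm f = linSubst N (X i) := by
  obtain ⟨N, M, h, rfl⟩ := exists_mul_eq_one_and_row_eq i hf
  exact ⟨N, M, h, (linSubst_X N i).symm⟩

end LinearForm

namespace PlaneCurve

section Form

theorem form_isHomogeneous (C : PlaneCurve) : C.form.IsHomogeneous C.degree :=
  (C.2.rep).2

theorem form_ne_zero (C : PlaneCurve) : C.form ≠ 0 := fun h =>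
  C.2.rep_nonzero (Subtype.ext h)

/-- The curve with a given equation. -/
noncomputable def ofForm (F : MvPolynomial (Fin 3) ℂ) (d : ℕ) (hF : F.IsHomogeneous d)
    (h0 : F ≠ 0) : PlaneCurve :=
  ⟨d, Projectivization.mk ℂ (⟨F, hF⟩ : homogeneousSubmodule (Fin 3) ℂ d)
    (fun h => h0 (congrArg Subtype.val h))⟩

theorem exists_form_ofForm_eq {F : MvPolynomial (Fin 3) ℂ} {d : ℕ} (hF : F.IsHomogeneous d)
    (h0 : F ≠ 0) : ∃ c : ℂ, c ≠ 0 ∧ (ofForm F d hF h0).form = MvPolynomial.C c * F := by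
  obtain ⟨a, ha⟩ := Projectivization.exists_smul_eq_mk_rep ℂ
    (⟨F, hF⟩ : homogeneousSubmodule (Fin 3) ℂ d) (fun h => h0 (congrArg Subtype.val h))
  refine ⟨a, a.ne_zero, ?_⟩
  rw [form, ofForm, ← congrArg Subtype.val ha, C_mul']
  rfl

theorem associated_form_ofForm {F : MvPolynomial (Fin 3) ℂ} {d : ℕ} (hF : F.IsHomogeneous d)
    (h0 : F ≠ 0) : Associated (ofForm F d hF h0).form F := by
  obtain ⟨c, hc, h⟩ := exists_form_ofForm_eq hF h0
  rw [h]
  exact associated_unit_mul_left _ _ ((isUnit_iff_ne_zero.2 hc).map MvPolynomial.C)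

theorem eq_of_form_dvd {C D : PlaneCurve} (hdeg : C.degree = D.degree) (h : C.form ∣ D.form) :
    C = D := by
  obtain ⟨d, c⟩ := C
  obtain ⟨d', c'⟩ := D
  obtain rfl : d = d' := hdeg
  have hc' : (c'.rep).1 ≠ 0 := form_ne_zero ⟨d, c'⟩
  have hc : (c.rep).1 ≠ 0 := form_ne_zero ⟨d, c⟩
  obtain ⟨Q, hQ⟩ : (c.rep).1 ∣ (c'.rep).1 := h
  have hQ0 : Q ≠ 0 := by
    rintro rfl
    exact hc' (by rw [hQ, mul_zero])
  have htotal := congrArg totalDegree hQ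
  rw [totalDegree_mul_of_isDomain hc hQ0, (c.rep).2.totalDegree hc,
    (c'.rep).2.totalDegree hc'] at htotal
  rw [(totalDegree_eq_zero_iff_eq_C).1 (by omega : Q.totalDegree = 0), mul_comm, C_mul'] at hQ
  congr 1
  rw [← c.mk_rep, ← c'.mk_rep, eq_comm, Projectivization.mk_eq_mk_iff']
  exact ⟨coeff 0 Q, Subtype.ext hQ.symm⟩

theorem IsIntegral.eq_of_dvd {C D : PlaneCurve} (hC : C.IsIntegral) (hD : D.IsIntegral)
    (h : D.form ∣ C.form) : D = C := by
  have hdvd : C.form ∣ D.form := (Irreducible.associated_of_dvd hD hC h).symm.dvd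
  have hle := totalDegree_le_of_dvd_of_isDomain h C.form_ne_zero
  have hge := totalDegree_le_of_dvd_of_isDomain hdvd D.form_ne_zero
  rw [C.form_isHomogeneous.totalDegree C.form_ne_zero,
    D.form_isHomogeneous.totalDegree D.form_ne_zero] at hle hge
  exact eq_of_form_dvd (le_antisymm hle hge) h

end Form

section Points

variable {C : PlaneCurve} {p : Plane}

theorem mem_points : p ∈ C.points ↔ eval p.rep C.form = 0 := Iff.rfl

theorem mk_mem_points {v : Fin 3 → ℂ} (hv : v ≠ 0) :
    Projectivization.mk ℂ v hv ∈ C.points ↔ eval v C.form = 0 := by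
  obtain ⟨a, ha⟩ := Projectivization.exists_smul_eq_mk_rep ℂ v hv
  rw [mem_points, ← ha, Units.smul_def, eval_smul_of_isHomogeneous C.form_isHomogeneous]
  simp

theorem mk_mem_points_ofForm {F : MvPolynomial (Fin 3) ℂ} {d : ℕ} (hF : F.IsHomogeneous d)
    (h0 : F ≠ 0) {v : Fin 3 → ℂ} (hv : v ≠ 0) :
    Projectivization.mk ℂ v hv ∈ (ofForm F d hF h0).points ↔ eval v F = 0 := by
  obtain ⟨c, hc, h⟩ := exists_form_ofForm_eq hF h0
  rw [mk_mem_points, h]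
  simp [hc]

theorem mem_points_ofForm {F : MvPolynomial (Fin 3) ℂ} {d : ℕ} (hF : F.IsHomogeneous d)
    (h0 : F ≠ 0) : p ∈ (ofForm F d hF h0).points ↔ eval p.rep F = 0 := by
  rw [← mk_mem_points_ofForm hF h0 p.rep_nonzero, p.mk_rep]

theorem form_dvd_of_points_subset {D : PlaneCurve} (hC : C.IsIntegral) (hD : 0 < D.degree)
    (h : C.points ⊆ D.points) : C.form ∣ D.form := by
  refine dvd_of_forall_eval_eq_zero hC fun v hv => ?_
  by_cases h0 : v = 0
  · have hzero := eval_smul_of_isHomogeneous D.form_isHomogeneous 0 v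
    rwa [zero_pow hD.ne', zero_mul, zero_smul, ← h0] at hzero
  · exact (mk_mem_points h0).1 (h ((mk_mem_points h0).2 hv))

theorem mult_eq_zero_iff : C.mult p = 0 ↔ p ∉ C.points :=
  orderAt_eq_zero_iff C.form_ne_zero

theorem mult_pos_iff : 0 < C.mult p ↔ p ∈ C.points := by
  rw [Nat.pos_iff_ne_zero, Ne, mult_eq_zero_iff, not_not]

theorem mult_eq_one_iff : C.mult p = 1 ↔ p ∈ C.points ∧ C.grad p ≠ 0 := by
  rw [Function.ne_iff]
  exact orderAt_eq_one_iff C.form_ne_zero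

theorem isSmooth_iff : C.IsSmooth ↔ IsNonsingularForm C.form := by
  constructor
  · intro h v hv h0
    obtain ⟨i, hi⟩ := Function.ne_iff.1 (mult_eq_one_iff.1 (h _ ((mk_mem_points hv).2 h0))).2
    obtain ⟨a, ha⟩ := Projectivization.exists_smul_eq_mk_rep ℂ v hv
    refine ⟨i, fun hzero => hi ?_⟩
    rw [grad, ← ha, Units.smul_def, eval_smul_of_isHomogeneous C.form_isHomogeneous.pderiv, hzero,
      mul_zero, Pi.zero_apply]
  · intro h p hp
    exact mult_eq_one_iff.2 ⟨hp, Function.ne_iff.2 (h _ p.rep_nonzero hp)⟩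

theorem isSmooth_ofForm {F : MvPolynomial (Fin 3) ℂ} {d : ℕ} (hF : F.IsHomogeneous d) (h0 : F ≠ 0)
    (hs : IsNonsingularForm F) : (ofForm F d hF h0).IsSmooth := by
  obtain ⟨c, hc, h⟩ := exists_form_ofForm_eq hF h0
  rw [isSmooth_iff, h]
  exact hs.C_mul hc

theorem IsSmooth.mult_eq (h : C.IsSmooth) (p : Plane) [Decidable (p ∈ C.points)] :
    C.mult p = if p ∈ C.points then 1 else 0 := by
  split_ifs with hp
  · exact h p hp
  · exact mult_eq_zero_iff.2 hp

theorem IsSmooth.grad_ne_zero (h : C.IsSmooth) (hp : p ∈ C.points) : C.grad p ≠ 0 :=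
  (mult_eq_one_iff.1 (h p hp)).2

end Points

section Bezout

/-- A rational curve whose equation is irreducible and whose points are parametrized by binary
forms of the degree of the curve. -/
def HasParametrization (C : PlaneCurve) : Prop := ∃ φ, IsParametrization C.form C.degree φ

theorem hasParametrization_ofForm {F : MvPolynomial (Fin 3) ℂ} {d : ℕ}
    {φ : Fin 3 → MvPolynomial (Fin 2) ℂ} (hF : F.IsHomogeneous d) (h0 : F ≠ 0)
    (hφ : IsParametrization F d φ) : (ofForm F d hF h0).HasParametrization := by
  obtain ⟨c, hc, h⟩ := exists_form_ofForm_eq hF h0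
  exact ⟨φ, h ▸ hφ.C_mul hc⟩

variable {C D : PlaneCurve}

theorem HasParametrization.isIntegral (hC : C.HasParametrization) : C.IsIntegral :=
  hC.choose_spec.irreducible

theorem sum_mult_le (hC : C.HasParametrization) (h : ¬ C.form ∣ D.form) (S : Finset Plane)
    (hS : ∀ p ∈ S, p ∈ C.points) : ∑ p ∈ S, D.mult p ≤ C.degree * D.degree :=
  hC.choose_spec.sum_le_of_hasContact D.form_isHomogeneous h S hS _
    fun p _ => hasContact_orderAt _ D.form_isHomogeneous p.rep

theorem card_le_of_subset_inter (hC : C.HasParametrization) (h : ¬ C.form ∣ D.form)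
    {S : Finset Plane} (hS : ∀ p ∈ S, p ∈ C.points ∧ p ∈ D.points) :
    S.card ≤ C.degree * D.degree := by
  refine le_trans ?_ (sum_mult_le hC h S fun p hp => (hS p hp).1)
  rw [Finset.card_eq_sum_ones]
  exact Finset.sum_le_sum fun p hp => mult_pos_iff.2 (hS p hp).2

theorem mem_of_card_eq (hC : C.HasParametrization) (h : ¬ C.form ∣ D.form)
    {S : Finset Plane} (hS : ∀ p ∈ S, p ∈ C.points ∧ p ∈ D.points)
    (hcard : S.card = C.degree * D.degree) {q : Plane} (hqC : q ∈ C.points)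
    (hqD : q ∈ D.points) : q ∈ S := by
  classical
  by_contra hq
  have hle := card_le_of_subset_inter hC h (S := insert q S) (by simpa [hqC, hqD] using hS)
  rw [Finset.card_insert_of_notMem hq] at hle
  omega

/-- Proportional gradients would make the intersection multiplicity at `q` at least two, one more
than Bézout's theorem allows. -/
theorem linearIndependent_grad_of_card_eq (hC : C.HasParametrization) (h : ¬ C.form ∣ D.form)
    (hsm : C.IsSmooth) {S : Finset Plane} (hS : ∀ p ∈ S, p ∈ C.points ∧ p ∈ D.points)
    (hcard : S.card = C.degree * D.degree) {q : Plane} (hq : q ∈ S) :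
    LinearIndependent ℂ ![C.grad q, D.grad q] := by
  classical
  rw [LinearIndependent.pair_iff' (hsm.grad_ne_zero (hS q hq).1)]
  intro a ha
  have hcontact : ∀ p ∈ S, HasContact C.form D.form p.rep (if p = q then 2 else 1) := by
    intro p hp
    split_ifs with hpq
    · subst hpq
      exact hasContact_two_of_smul_eq C.form_isHomogeneous D.form_isHomogeneous (hS p hp).2
        (congrFun ha)
    · exact hasContact_one_of_eval_eq_zero _ D.form_isHomogeneous (hS p hp).2
  have hle := hC.choose_spec.sum_le_of_hasContact D.form_isHomogeneous h S
    (fun p hp => (hS p hp).1) _ hcontact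
  have hsum : ∑ p ∈ S, (if p = q then 2 else 1) = S.card + 1 := by
    have hite : ∀ p, (if p = q then 2 else 1) = 1 + if p = q then 1 else 0 := fun p => by
      split_ifs <;> rfl
    simp only [hite, Finset.sum_add_distrib, Finset.sum_ite_eq', if_pos hq, Finset.sum_const,
      smul_eq_mul, mul_one]
  rw [hsum] at hle
  omega

end Bezout

section LinesAndConics

/-- The line dual to `p`, that is the pencil of all lines through `p`. -/
noncomputable def dualLine (p : Plane) : PlaneCurve :=
  ofForm (linearForm p.rep) 1 (linearForm_isHomogeneous _) (linearForm_ne_zero p.rep_nonzero)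

theorem degree_dualLine (p : Plane) : (dualLine p).degree = 1 := rfl

theorem mem_points_dualLine {p q : Plane} : q ∈ (dualLine p).points ↔ p.rep ⬝ᵥ q.rep = 0 := by
  rw [dualLine, mem_points_ofForm, eval_linearForm]

theorem mk_mem_points_dualLine_mk {f v : Fin 3 → ℂ} (hf : f ≠ 0) (hv : v ≠ 0) :
    Projectivization.mk ℂ v hv ∈ (dualLine (Projectivization.mk ℂ f hf)).points ↔
      f ⬝ᵥ v = 0 := by
  obtain ⟨a, ha⟩ := Projectivization.exists_smul_eq_mk_rep ℂ f hf
  rw [dualLine, mk_mem_points_ofForm, eval_linearForm, ← ha, smul_dotProduct,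
    smul_eq_zero_iff_eq]

theorem hasParametrization_dualLine (p : Plane) : (dualLine p).HasParametrization := by
  obtain ⟨N, M, h, hform⟩ := exists_linearForm_eq_linSubst 0 p.rep_nonzero
  exact hasParametrization_ofForm _ _ (hform ▸ isParametrization_line.linSubst h)

theorem isSmooth_dualLine (p : Plane) : (dualLine p).IsSmooth := by
  obtain ⟨N, M, h, hform⟩ := exists_linearForm_eq_linSubst 0 p.rep_nonzero
  refine isSmooth_ofForm _ _ ?_
  rw [hform]
  exact (isNonsingularForm_X 0).linSubst h

theorem eq_dualLine {L : PlaneCurve} (hL : L.degree = 1) {p : Plane}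
    (h : L.points = {q | p.rep ⬝ᵥ q.rep = 0}) : L = dualLine p := by
  refine (eq_of_form_dvd (C := dualLine p) hL.symm ?_).symm
  refine form_dvd_of_points_subset (hasParametrization_dualLine p).isIntegral (by omega) ?_
  rw [h]
  exact fun q hq => mem_points_dualLine.1 hq

theorem isHomogeneous_conic (N : Matrix (Fin 3) (Fin 3) ℂ) :
    (linSubst N (X 1 * X 2 - X 0 ^ 2)).IsHomogeneous 2 :=
  linSubst_isHomogeneous N
    (((isHomogeneous_X _ _).mul (isHomogeneous_X _ _)).sub (isHomogeneous_X_pow _ _))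

/-- The smooth conic `y * z = x ^ 2`, where `(x, y, z)` is the image of the point under the matrix
`N` with inverse `M`. -/
noncomputable def conicOfFrame (N M : Matrix (Fin 3) (Fin 3) ℂ) (h : M * N = 1) : PlaneCurve :=
  ofForm (linSubst N (X 1 * X 2 - X 0 ^ 2)) 2 (isHomogeneous_conic N)
    (isParametrization_conic.linSubst h).irreducible.ne_zero

variable {N M : Matrix (Fin 3) (Fin 3) ℂ} (h : M * N = 1)

theorem degree_conicOfFrame : (conicOfFrame N M h).degree = 2 := rfl

theorem mk_mem_points_conicOfFrame {v : Fin 3 → ℂ} (hv : v ≠ 0) :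
    Projectivization.mk ℂ v hv ∈ (conicOfFrame N M h).points ↔
      N.mulVec v 1 * N.mulVec v 2 = N.mulVec v 0 ^ 2 := by
  rw [conicOfFrame, mk_mem_points_ofForm, eval_linSubst, map_sub, sub_eq_zero]
  simp only [map_mul, map_pow, eval_X]

theorem hasParametrization_conicOfFrame : (conicOfFrame N M h).HasParametrization :=
  hasParametrization_ofForm _ _ (isParametrization_conic.linSubst h)

theorem isSmooth_conicOfFrame : (conicOfFrame N M h).IsSmooth :=
  isSmooth_ofForm _ _ (isNonsingularForm_conic.linSubst h)

end LinesAndConics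

end PlaneCurve

theorem dualHesseLines_eq_image (E : PlaneCurve) :
    dualHesseLines E = PlaneCurve.dualLine '' E.flexes := by
  ext L
  constructor
  · rintro ⟨hL, p, hp, hpoints⟩
    exact ⟨p, hp, (PlaneCurve.eq_dualLine hL hpoints).symm⟩
  · rintro ⟨p, hp, rfl⟩
    exact ⟨rfl, p, hp, Set.ext fun q => PlaneCurve.mem_points_dualLine⟩

section FiniteFamilies

theorem ncard_range_inter {κ β : Type*} [Fintype κ] {P : κ → β} (hP : Function.Injective P)
    (s : Set β) [DecidablePred fun x => P x ∈ s] :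
    (Set.range P ∩ s).ncard = (Finset.univ.filter fun x => P x ∈ s).card := by
  rw [Set.inter_comm, ← Set.image_preimage_eq_inter_range, Set.ncard_image_of_injective _ hP,
    ← Set.ncard_coe_finset, Finset.coe_filter_univ]
  rfl

theorem finsum_mem_range_eq_sum {κ β M : Type*} [Fintype κ] [AddCommMonoid M] {P : κ → β}
    (hP : Function.Injective P) (f : β → M) : ∑ᶠ q ∈ Set.range P, f q = ∑ x, f (P x) := by
  rw [finsum_mem_range hP, finsum_eq_sum_of_fintype]

end FiniteFamilies

namespace PlaneCurve

variable {κ : Type*} [Fintype κ] {P : κ → Plane} {C D : PlaneCurve}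

section Inter

variable [DecidablePred fun x => P x ∈ C.points ∧ P x ∈ D.points] (hC : C.HasParametrization)
  (h : ¬ C.form ∣ D.form) (hP : Function.Injective P)
  (hcard : (Finset.univ.filter fun x => P x ∈ C.points ∧ P x ∈ D.points).card =
    C.degree * D.degree) {q : Plane} (hqC : q ∈ C.points) (hqD : q ∈ D.points)
include hC h hP hcard hqC hqD

theorem mem_map_of_card_eq :
    q ∈ (Finset.univ.filter fun x => P x ∈ C.points ∧ P x ∈ D.points).map ⟨P, hP⟩ :=
  mem_of_card_eq (S := (Finset.univ.filter fun x => P x ∈ C.points ∧ P x ∈ D.points).map ⟨P, hP⟩)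
    hC h (Finset.forall_mem_map.2 fun _ hx => (Finset.mem_filter.1 hx).2)
    ((Finset.card_map _).trans hcard) hqC hqD

theorem mem_range_of_card_eq : q ∈ Set.range P := by
  obtain ⟨x, -, hx⟩ := Finset.mem_map.1 (mem_map_of_card_eq hC h hP hcard hqC hqD)
  exact ⟨x, hx⟩

theorem linearIndependent_grad_of_mem_inter (hsm : C.IsSmooth) :
    LinearIndependent ℂ ![C.grad q, D.grad q] :=
  linearIndependent_grad_of_card_eq hC h hsm
    (S := (Finset.univ.filter fun x => P x ∈ C.points ∧ P x ∈ D.points).map ⟨P, hP⟩)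
    (Finset.forall_mem_map.2 fun _ hx => (Finset.mem_filter.1 hx).2)
    ((Finset.card_map _).trans hcard) (mem_map_of_card_eq hC h hP hcard hqC hqD)

end Inter

theorem sum_mult_le_of_cover {ι : Type*} [Fintype ι] {K : ι → PlaneCurve}
    (hK : ∀ i, (K i).HasParametrization) (hdvd : ∀ i, ¬ (K i).form ∣ C.form)
    (hP : Function.Injective P) (hcover : ∀ x, ∃ i, P x ∈ (K i).points) :
    ∑ x, C.mult (P x) ≤ (∑ i, (K i).degree) * C.degree := by
  classical
  have hbezout : ∀ i, ∑ x, (if P x ∈ (K i).points then C.mult (P x) else 0) ≤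
      (K i).degree * C.degree := fun i => by
    have hle := sum_mult_le (hK i) (hdvd i)
      ((Finset.univ.filter fun x => P x ∈ (K i).points).map ⟨P, hP⟩) (by simp)
    rwa [Finset.sum_map, Finset.sum_filter] at hle
  rw [Finset.sum_mul]
  refine le_trans ?_ (Finset.sum_le_sum fun i _ => hbezout i)
  rw [Finset.sum_comm]
  refine Finset.sum_le_sum fun x _ => ?_
  obtain ⟨i, hi⟩ := hcover x
  exact (if_pos hi).ge.trans (Finset.single_le_sum
    (f := fun i => if P x ∈ (K i).points then C.mult (P x) else 0)
    (fun _ _ => Nat.zero_le _) (Finset.mem_univ i))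

theorem seshadriRatio_range (hP : Function.Injective P) :
    C.seshadriRatio (Set.range P) = C.degree / (∑ x, C.mult (P x) : ℕ) := by
  rw [seshadriRatio, finsum_mem_range_eq_sum hP]

theorem IsSmooth.seshadriRatio_range (hC : C.IsSmooth) (hP : Function.Injective P)
    [DecidablePred fun x => P x ∈ C.points] :
    C.seshadriRatio (Set.range P) =
      C.degree / (Finset.univ.filter fun x => P x ∈ C.points).card := by
  rw [PlaneCurve.seshadriRatio_range hP, Finset.card_filter,
    Finset.sum_congr rfl fun x _ => hC.mult_eq (P x)]

end PlaneCurve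

namespace Arrangement

variable {ι : Type*} {K : ι → PlaneCurve} (hK : Function.Injective K) (hs : ∀ i, (K i).IsSmooth)
include hK hs

theorem mem_sing_range_iff {q : Plane} : q ∈ sing (Set.range K) ↔
    ∃ i j, i ≠ j ∧ q ∈ (K i).points ∧ q ∈ (K j).points := by
  constructor
  · rintro (⟨_, ⟨i, rfl⟩, hmult⟩ | ⟨_, ⟨i, rfl⟩, _, ⟨j, rfl⟩, hne, hi, hj⟩)
    · have hone := hs i q (PlaneCurve.mult_pos_iff.1 (by omega))
      omega
    · exact ⟨i, j, fun h => hne (congrArg K h), hi, hj⟩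
  · rintro ⟨i, j, hne, hi, hj⟩
    exact .inr ⟨_, ⟨i, rfl⟩, _, ⟨j, rfl⟩, hK.ne hne, hi, hj⟩

theorem mult_range [Fintype ι] (q : Plane) [DecidablePred fun i => q ∈ (K i).points] :
    mult (Set.range K) q = (Finset.univ.filter fun i => q ∈ (K i).points).card := by
  rw [mult, finsum_mem_range_eq_sum hK, Finset.card_filter,
    Finset.sum_congr rfl fun i _ => (hs i).mult_eq q]

end Arrangement

section AffinePlane

/-- The points of the affine plane over the field with three elements. -/
abbrev AffPoint : Type := ZMod 3 × ZMod 3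

/-- The lines of the affine plane over the field with three elements: `(none, i)` is the vertical
line `x = i` and `(some s, t)` is the line `y = s * x + t`, so that the first component is the
parallel class. -/
abbrev AffLine : Type := Option (ZMod 3) × ZMod 3

/-- Incidence of points and lines of the affine plane. -/
def Inc (a : AffPoint) (l : AffLine) : Prop :=
  l.1.elim (a.1 = l.2) fun s => a.2 = s * a.1 + l.2

theorem inc_none {i k t : ZMod 3} : Inc (i, k) (none, t) ↔ i = t := Iff.rfl

theorem inc_some {i k s t : ZMod 3} : Inc (i, k) (some s, t) ↔ k = s * i + t := Iff.rfl

instance (a : AffPoint) (l : AffLine) : Decidable (Inc a l) := by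
  obtain ⟨_ | s, t⟩ := l <;> (simp only [Inc, Option.elim]; infer_instance)

/-- The incidences of the `9` cusps and `12` nodes with the `9` lines of a Hesse configuration. -/
def OnLine : AffPoint ⊕ AffLine → AffPoint → Prop
  | .inl b, a => b = a
  | .inr l, a => Inc a l

/-- The incidences of the `9` cusps and `12` nodes with the `12` conics of a Hesse configuration:
a conic misses the cusps on its line and contains the nodes of the two parallels. -/
def OnConic : AffPoint ⊕ AffLine → AffLine → Prop
  | .inl a, l => ¬ Inc a l
  | .inr m, l => m.1 = l.1 ∧ m ≠ l

instance (x : AffPoint ⊕ AffLine) (a : AffPoint) : Decidable (OnLine x a) := by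
  cases x <;> (simp only [OnLine]; infer_instance)

instance (x : AffPoint ⊕ AffLine) (l : AffLine) : Decidable (OnConic x l) := by
  cases x <;> (simp only [OnConic]; infer_instance)

theorem eq_of_onLine_iff : ∀ {x y}, (∀ a, OnLine x a ↔ OnLine y a) → x = y := by decide

theorem eq_of_inc_iff : ∀ {l m}, (∀ a, Inc a l ↔ Inc a m) → l = m := by decide

theorem card_onLine_inter : ∀ {a b}, a ≠ b →
    (Finset.univ.filter fun x => OnLine x a ∧ OnLine x b).card = 1 := by decide

theorem card_onConic_inter : ∀ {l m}, l ≠ m →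
    (Finset.univ.filter fun x => OnConic x l ∧ OnConic x m).card = 4 := by decide

theorem exists_onConic_inter : ∀ x, ∃ l m, l ≠ m ∧ OnConic x l ∧ OnConic x m := by decide

theorem exists_not_onConic : ∀ x, ∃ l, ¬ OnConic x l := by decide

theorem exists_onLine_inter_iff : ∀ x, (∃ a b, a ≠ b ∧ OnLine x a ∧ OnLine x b) ↔
    ∃ l, x = .inr l := by decide

theorem onLine_or_onConic : ∀ x, (∃ k, OnLine x (0, k)) ∨ OnConic x (none, 0) := by decide

theorem exists_inc_inter : ∀ a b : AffPoint, ∃ l, Inc a l ∧ Inc b l := by decide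

theorem card_inc_diff_pair : ∀ {a b : AffPoint} {l : AffLine}, a ≠ b → Inc a l → Inc b l →
    (Finset.univ.filter fun x => Inc x l ∧ x ≠ a ∧ x ≠ b).card = 1 := by decide

/-- The line is the one through two of the three points missing from `s`. -/
theorem exists_five_le_card_not_inc {s : Finset AffPoint} (hs : s.card = 6) :
    ∃ l, 5 ≤ (s.filter fun a => ¬ Inc a l).card := by
  have hcompl : 1 < (sᶜ).card := by
    rw [Finset.card_compl, hs]
    decide
  obtain ⟨a, ha, b, hb, hab⟩ := Finset.one_lt_card.1 hcompl
  rw [Finset.mem_compl] at ha hb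
  obtain ⟨l, hal, hbl⟩ := exists_inc_inter a b
  have hle : (s.filter fun x => Inc x l).card ≤ 1 := by
    rw [← card_inc_diff_pair hab hal hbl]
    refine Finset.card_le_card fun x hx => ?_
    rw [Finset.mem_filter] at hx ⊢
    exact ⟨Finset.mem_univ _, hx.2, fun h => ha (h ▸ hx.1), fun h => hb (h ▸ hx.1)⟩
  have hsplit := Finset.card_filter_add_card_filter_not (s := s) (fun x => Inc x l)
  exact ⟨l, by omega⟩

end AffinePlane

/-- Nine cusps, twelve nodes, nine lines and twelve conics of the plane, indexed by the points and
lines of the affine plane over the field with three elements and with the incidences prescribed by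
`OnLine` and `OnConic`. -/
structure HesseConfiguration where
  point : AffPoint ⊕ AffLine → Plane
  line : AffPoint → PlaneCurve
  conic : AffLine → PlaneCurve
  degree_line : ∀ a, (line a).degree = 1
  degree_conic : ∀ l, (conic l).degree = 2
  hasParametrization_line : ∀ a, (line a).HasParametrization
  hasParametrization_conic : ∀ l, (conic l).HasParametrization
  isSmooth_line : ∀ a, (line a).IsSmooth
  isSmooth_conic : ∀ l, (conic l).IsSmooth
  mem_line : ∀ x a, point x ∈ (line a).points ↔ OnLine x a
  mem_conic : ∀ x l, point x ∈ (conic l).points ↔ OnConic x l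

namespace HesseConfiguration

variable (H : HesseConfiguration)

/-- The cusps of a Hesse configuration. -/
def cusp (a : AffPoint) : Plane := H.point (.inl a)

/-- The nodes of a Hesse configuration. -/
def node (l : AffLine) : Plane := H.point (.inr l)

theorem cusp_mem_line {a b : AffPoint} : H.cusp b ∈ (H.line a).points ↔ b = a := H.mem_line _ a

theorem node_mem_line {a : AffPoint} {l : AffLine} : H.node l ∈ (H.line a).points ↔ Inc a l :=
  H.mem_line _ a

theorem cusp_mem_conic {a : AffPoint} {l : AffLine} : H.cusp a ∈ (H.conic l).points ↔ ¬ Inc a l :=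
  H.mem_conic _ l

theorem node_mem_conic {m l : AffLine} :
    H.node m ∈ (H.conic l).points ↔ m.1 = l.1 ∧ m ≠ l := H.mem_conic _ l

theorem range_point : Set.range H.point = Set.range H.cusp ∪ Set.range H.node := by
  rw [← Set.Sum.elim_range]
  congr 1
  funext x
  cases x <;> rfl

theorem point_injective : Function.Injective H.point := fun x y h =>
  eq_of_onLine_iff fun a => by rw [← H.mem_line, h, H.mem_line]

theorem cusp_injective : Function.Injective H.cusp :=
  H.point_injective.comp Sum.inl_injective

theorem node_injective : Function.Injective H.node :=
  H.point_injective.comp Sum.inr_injective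

theorem line_injective : Function.Injective H.line := fun a b h => by
  rw [← H.cusp_mem_line, ← h, H.cusp_mem_line]

theorem conic_injective : Function.Injective H.conic := fun l m h =>
  eq_of_inc_iff fun a => by rw [← not_iff_not, ← H.cusp_mem_conic, h, H.cusp_mem_conic]

section Inter

theorem not_conic_dvd {l m : AffLine} (h : l ≠ m) : ¬ (H.conic l).form ∣ (H.conic m).form :=
  fun hdvd => H.conic_injective.ne h <|
    PlaneCurve.eq_of_form_dvd (by rw [H.degree_conic, H.degree_conic]) hdvd

theorem not_line_dvd {a b : AffPoint} (h : a ≠ b) : ¬ (H.line a).form ∣ (H.line b).form :=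
  fun hdvd => H.line_injective.ne h <|
    PlaneCurve.eq_of_form_dvd (by rw [H.degree_line, H.degree_line]) hdvd

open Classical in
theorem card_conic_inter {l m : AffLine} (h : l ≠ m) :
    (Finset.univ.filter fun x => H.point x ∈ (H.conic l).points ∧
      H.point x ∈ (H.conic m).points).card = (H.conic l).degree * (H.conic m).degree := by
  simp only [H.mem_conic, H.degree_conic]
  convert card_onConic_inter h

open Classical in
theorem card_line_inter {a b : AffPoint} (h : a ≠ b) :
    (Finset.univ.filter fun x => H.point x ∈ (H.line a).points ∧
      H.point x ∈ (H.line b).points).card = (H.line a).degree * (H.line b).degree := by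
  simp only [H.mem_line, H.degree_line]
  convert card_onLine_inter h

end Inter

section Conics

theorem isOrdinaryAt (q : Plane) : Arrangement.IsOrdinaryAt (Set.range H.conic) q := by
  classical
  refine ⟨?_, ?_⟩
  · rintro _ ⟨l, rfl⟩ hq
    exact H.isSmooth_conic l q hq
  · rintro _ ⟨l, rfl⟩ _ ⟨m, rfl⟩ hne hl hm
    have hlm : l ≠ m := fun h => hne (congrArg H.conic h)
    exact PlaneCurve.linearIndependent_grad_of_mem_inter (H.hasParametrization_conic l)
      (H.not_conic_dvd hlm) H.point_injective (H.card_conic_inter hlm) hl hm (H.isSmooth_conic l)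

theorem sing_conics : Arrangement.sing (Set.range H.conic) = Set.range H.point := by
  classical
  ext q
  rw [Arrangement.mem_sing_range_iff H.conic_injective H.isSmooth_conic]
  constructor
  · rintro ⟨l, m, hne, hl, hm⟩
    exact PlaneCurve.mem_range_of_card_eq (H.hasParametrization_conic l) (H.not_conic_dvd hne)
      H.point_injective (H.card_conic_inter hne) hl hm
  · rintro ⟨x, rfl⟩
    simpa only [H.mem_conic] using exists_onConic_inter x

theorem mult_conics_cusp (a : AffPoint) :
    Arrangement.mult (Set.range H.conic) (H.cusp a) = 8 := by
  classical
  rw [Arrangement.mult_range H.conic_injective H.isSmooth_conic]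
  simp only [H.cusp_mem_conic]
  revert a
  decide

theorem mult_conics_node (k : AffLine) :
    Arrangement.mult (Set.range H.conic) (H.node k) = 2 := by
  classical
  rw [Arrangement.mult_range H.conic_injective H.isSmooth_conic]
  simp only [H.node_mem_conic]
  revert k
  decide

theorem nodes_conics : Arrangement.nodes (Set.range H.conic) = Set.range H.node := by
  ext q
  constructor
  · rintro ⟨hsing, hmult, -⟩
    rw [H.sing_conics, H.range_point] at hsing
    rcases hsing with ⟨a, rfl⟩ | hnode
    · rw [H.mult_conics_cusp] at hmult
      omega
    · exact hnode
  · rintro ⟨k, rfl⟩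
    exact ⟨H.sing_conics ▸ ⟨_, rfl⟩, H.mult_conics_node k, H.isOrdinaryAt _⟩

theorem ncard_range_conic : (Set.range H.conic).ncard = 12 := by
  rw [Set.ncard_range_of_injective H.conic_injective, Nat.card_eq_fintype_card]
  decide

theorem isDArrangement : Arrangement.IsDArrangement 2 (Set.range H.conic) := by
  refine ⟨Set.finite_range _, by rw [H.ncard_range_conic]; norm_num, ?_,
    fun q _ => H.isOrdinaryAt q, ?_⟩
  · rintro _ ⟨l, rfl⟩
    exact ⟨H.degree_conic l, H.isSmooth_conic l⟩
  · rintro ⟨q, hq⟩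
    have hsing : q ∈ Arrangement.sing (Set.range H.conic) :=
      (Arrangement.mem_sing_range_iff H.conic_injective H.isSmooth_conic).2
        ⟨(none, 0), (none, 1), by decide, hq _ ⟨_, rfl⟩, hq _ ⟨_, rfl⟩⟩
    rw [H.sing_conics] at hsing
    obtain ⟨x, rfl⟩ := hsing
    obtain ⟨l, hl⟩ := exists_not_onConic x
    exact hl ((H.mem_conic x l).1 (hq _ ⟨l, rfl⟩))

theorem ncard_range_cusp : (Set.range H.cusp).ncard = 9 := by
  rw [Set.ncard_range_of_injective H.cusp_injective, Nat.card_eq_fintype_card]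
  decide

theorem ncard_range_node : (Set.range H.node).ncard = 12 := by
  rw [Set.ncard_range_of_injective H.node_injective, Nat.card_eq_fintype_card]
  decide

theorem ncard_range_point : (Set.range H.point).ncard = 21 := by
  rw [Set.ncard_range_of_injective H.point_injective, Nat.card_eq_fintype_card]
  decide

theorem ncard_cusps_inter_conic (l : AffLine) :
    (Set.range H.cusp ∩ (H.conic l).points).ncard = 6 := by
  classical
  rw [ncard_range_inter H.cusp_injective]
  simp only [H.cusp_mem_conic]
  revert l
  decide

theorem ncard_nodes_inter_conic (l : AffLine) :
    (Set.range H.node ∩ (H.conic l).points).ncard = 2 := by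
  classical
  rw [ncard_range_inter H.node_injective]
  simp only [H.node_mem_conic]
  revert l
  decide

theorem conic_eq_of_ncard_inter {C : PlaneCurve} (hC : C.degree = 2)
    (h : (Set.range H.cusp ∩ C.points).ncard = 6) : ∃ l, H.conic l = C := by
  classical
  rw [ncard_range_inter H.cusp_injective] at h
  obtain ⟨l, hl⟩ := exists_five_le_card_not_inc h
  refine ⟨l, PlaneCurve.eq_of_form_dvd ((H.degree_conic l).trans hC.symm) ?_⟩
  by_contra hdvd
  have hle := PlaneCurve.card_le_of_subset_inter (H.hasParametrization_conic l) hdvd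
    (S := ((Finset.univ.filter fun a => H.cusp a ∈ C.points).filter fun a => ¬ Inc a l).map
      ⟨H.cusp, H.cusp_injective⟩) (Finset.forall_mem_map.2 fun a ha => by
        obtain ⟨hC, hl⟩ := Finset.mem_filter.1 ha
        exact ⟨H.cusp_mem_conic.2 hl, (Finset.mem_filter.1 hC).2⟩)
  rw [Finset.card_map, H.degree_conic, hC] at hle
  omega

theorem configurationalSeshadri_conics :
    Arrangement.configurationalSeshadri (Set.range H.conic) = 1 / 4 := by
  have hdegree : ∑ᶠ C ∈ Set.range H.conic, C.degree = 24 := by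
    simp only [finsum_mem_range_eq_sum H.conic_injective, H.degree_conic]
    decide
  have hmult : ∑ᶠ p ∈ Set.range H.point, Arrangement.mult (Set.range H.conic) p = 96 := by
    have hcusp := H.mult_conics_cusp
    have hnode := H.mult_conics_node
    unfold cusp at hcusp
    unfold node at hnode
    simp only [finsum_mem_range_eq_sum H.point_injective, Fintype.sum_sum_type, hcusp, hnode]
    decide
  rw [Arrangement.configurationalSeshadri, H.sing_conics, hdegree, hmult]
  norm_num

end Conics

section Lines

theorem sing_lines : Arrangement.sing (Set.range H.line) = Set.range H.node := by
  classical
  ext q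
  rw [Arrangement.mem_sing_range_iff H.line_injective H.isSmooth_line]
  constructor
  · rintro ⟨a, b, hne, ha, hb⟩
    obtain ⟨x, rfl⟩ := PlaneCurve.mem_range_of_card_eq (H.hasParametrization_line a)
      (H.not_line_dvd hne) H.point_injective (H.card_line_inter hne) ha hb
    rw [H.mem_line] at ha hb
    obtain ⟨l, rfl⟩ := (exists_onLine_inter_iff x).1 ⟨a, b, hne, ha, hb⟩
    exact ⟨l, rfl⟩
  · rintro ⟨l, rfl⟩
    simpa only [node, H.mem_line] using (exists_onLine_inter_iff (.inr l)).2 ⟨l, rfl⟩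

theorem mult_lines_node (k : AffLine) :
    Arrangement.mult (Set.range H.line) (H.node k) = 3 := by
  classical
  rw [Arrangement.mult_range H.line_injective H.isSmooth_line]
  simp only [H.node_mem_line]
  revert k
  decide

theorem ncard_range_line : (Set.range H.line).ncard = 9 := by
  rw [Set.ncard_range_of_injective H.line_injective, Nat.card_eq_fintype_card]
  decide

theorem ncard_cusps_inter_line (a : AffPoint) :
    (Set.range H.cusp ∩ (H.line a).points).ncard = 1 := by
  classical
  rw [ncard_range_inter H.cusp_injective]
  simp only [H.cusp_mem_line]
  revert a
  decide

theorem ncard_nodes_inter_line (a : AffPoint) :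
    (Set.range H.node ∩ (H.line a).points).ncard = 4 := by
  classical
  rw [ncard_range_inter H.node_injective]
  simp only [H.node_mem_line]
  revert a
  decide

end Lines

section Seshadri

theorem seshadriRatio_conic (l : AffLine) :
    (H.conic l).seshadriRatio (Set.range H.point) = 1 / 4 := by
  classical
  have hcard : (Finset.univ.filter fun x => H.point x ∈ (H.conic l).points).card = 8 := by
    simp only [H.mem_conic]
    revert l
    decide
  rw [(H.isSmooth_conic l).seshadriRatio_range H.point_injective, hcard, H.degree_conic]
  norm_num

theorem seshadriRatio_line (a : AffPoint) :
    (H.line a).seshadriRatio (Set.range H.point) = 1 / 5 := by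
  classical
  have hcard : (Finset.univ.filter fun x => H.point x ∈ (H.line a).points).card = 5 := by
    simp only [H.mem_line]
    revert a
    decide
  rw [(H.isSmooth_line a).seshadriRatio_range H.point_injective, hcard, H.degree_line]
  norm_num

/-- The components of a quintic through all the points of a Hesse configuration. -/
def quinticComponent : Option (ZMod 3) → PlaneCurve
  | none => H.conic (none, 0)
  | some k => H.line (0, k)

theorem exists_mem_quinticComponent (x : AffPoint ⊕ AffLine) :
    ∃ i, H.point x ∈ (H.quinticComponent i).points := by
  rcases onLine_or_onConic x with ⟨k, hk⟩ | hx
  · exact ⟨some k, (H.mem_line _ _).2 hk⟩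
  · exact ⟨none, (H.mem_conic _ _).2 hx⟩

theorem sum_degree_quinticComponent : ∑ i, (H.quinticComponent i).degree = 5 := by
  rw [Fintype.sum_option]
  simp only [quinticComponent, H.degree_conic, H.degree_line]
  decide

theorem exists_quintic : ∃ Q : PlaneCurve, Q.degree = 5 ∧
    Associated Q.form ((H.line (0, 0)).form * (H.line (0, 1)).form * (H.line (0, 2)).form *
      (H.conic (none, 0)).form) ∧ Set.range H.point ⊆ Q.points := by
  have hprod : ∏ i, (H.quinticComponent i).form = (H.line (0, 0)).form * (H.line (0, 1)).form *
      (H.line (0, 2)).form * (H.conic (none, 0)).form := by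
    rw [Fintype.prod_option, mul_comm]
    exact congrArg (· * _) (Fin.prod_univ_three fun k : Fin 3 => (H.quinticComponent (some k)).form)
  have hne : ∏ i, (H.quinticComponent i).form ≠ 0 :=
    Finset.prod_ne_zero_iff.2 fun i _ => (H.quinticComponent i).form_ne_zero
  have hhom : (∏ i, (H.quinticComponent i).form).IsHomogeneous 5 := by
    rw [← H.sum_degree_quinticComponent]
    exact IsHomogeneous.prod _ _ _ fun i _ => (H.quinticComponent i).form_isHomogeneous
  refine ⟨PlaneCurve.ofForm _ 5 hhom hne, rfl,
    hprod ▸ PlaneCurve.associated_form_ofForm hhom hne, ?_⟩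
  rintro _ ⟨x, rfl⟩
  obtain ⟨i, hi⟩ := H.exists_mem_quinticComponent x
  rw [PlaneCurve.mem_points_ofForm, map_prod]
  exact Finset.prod_eq_zero (Finset.mem_univ i) hi

theorem one_fifth_le_seshadriRatio {C : PlaneCurve} (hC : C.IsIntegral)
    (hmeet : (Set.range H.point ∩ C.points).Nonempty) :
    1 / 5 ≤ C.seshadriRatio (Set.range H.point) := by
  have hK : ∀ i, (H.quinticComponent i).HasParametrization ∧
      1 / 5 ≤ (H.quinticComponent i).seshadriRatio (Set.range H.point) := by
    rintro (_ | k)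
    · exact ⟨H.hasParametrization_conic _, (H.seshadriRatio_conic _).ge.trans' (by norm_num)⟩
    · exact ⟨H.hasParametrization_line _, (H.seshadriRatio_line _).ge⟩
  by_cases hdvd : ∃ i, (H.quinticComponent i).form ∣ C.form
  · obtain ⟨i, hi⟩ := hdvd
    exact hC.eq_of_dvd (hK i).1.isIntegral hi ▸ (hK i).2
  · have hle := PlaneCurve.sum_mult_le_of_cover (fun i => (hK i).1) (not_exists.1 hdvd)
      H.point_injective H.exists_mem_quinticComponent
    rw [H.sum_degree_quinticComponent] at hle
    obtain ⟨_, ⟨x, rfl⟩, hx⟩ := hmeet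
    have hpos : 0 < ∑ x, C.mult (H.point x) :=
      Finset.sum_pos' (fun _ _ => Nat.zero_le _)
        ⟨x, Finset.mem_univ x, PlaneCurve.mult_pos_iff.2 hx⟩
    rw [PlaneCurve.seshadriRatio_range H.point_injective, div_le_div_iff₀ (by norm_num)
      (by exact_mod_cast hpos), one_mul, mul_comm]
    exact_mod_cast hle

theorem seshadriConstant_eq : seshadriConstant (Set.range H.point) = 1 / 5 := by
  refine IsLeast.csInf_eq ⟨?_, ?_⟩
  · exact ⟨H.line 0, (H.hasParametrization_line 0).isIntegral,
      ⟨H.cusp 0, ⟨_, rfl⟩, H.cusp_mem_line.2 rfl⟩, (H.seshadriRatio_line 0).symm⟩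
  · rintro _ ⟨C, hC, hmeet, rfl⟩
    exact H.one_fifth_le_seshadriRatio hC hmeet

end Seshadri

end HesseConfiguration

section Hessian

variable {R σ : Type*} [CommRing R]

/-- The Hessian matrix of a polynomial at a point. -/
noncomputable def hessian (F : MvPolynomial σ R) (v : σ → R) : Matrix σ σ R :=
  Matrix.of fun i j => eval v (pderiv i (pderiv j F))

theorem pderiv_pderiv_comm (i j : σ) (F : MvPolynomial σ R) :
    pderiv i (pderiv j F) = pderiv j (pderiv i F) := by
  classical
  let D (k : σ) : Derivation R (MvPolynomial σ R) (MvPolynomial σ R) := pderiv k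
  have hbracket : ⁅D i, D j⁆ = 0 := derivation_ext fun k => by
    simp [D, Derivation.commutator_apply, pderiv_X, Pi.single_apply, apply_ite]
  have h := DFunLike.congr_fun hbracket F
  rwa [Derivation.commutator_apply, Derivation.zero_apply, sub_eq_zero] at h

theorem hessian_isSymm (F : MvPolynomial σ R) (v : σ → R) : (hessian F v).IsSymm :=
  Matrix.IsSymm.ext fun i j => congrArg (eval v) (pderiv_pderiv_comm j i F)

theorem hessian_linSubst {τ : Type*} [Fintype σ] [Fintype τ] (N : Matrix σ τ R)
    (F : MvPolynomial σ R) (v : τ → R) :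
    hessian (linSubst N F) v = N.transpose * hessian F (N.mulVec v) * N := by
  ext i j
  simp only [hessian, Matrix.of_apply, pderiv_linSubst, map_sum, pderiv_C_mul, map_mul, eval_C,
    eval_linSubst, Matrix.mul_apply, Matrix.transpose_apply, Finset.mul_sum, Finset.sum_mul]
  refine Finset.sum_congr rfl fun k _ => Finset.sum_congr rfl fun l _ => ?_
  ring

theorem hessian_smul {F : MvPolynomial σ R} {n : ℕ} (hF : F.IsHomogeneous (n + 2)) (c : R)
    (v : σ → R) : hessian F (c • v) = c ^ n • hessian F v := by
  ext i j
  exact eval_smul_of_isHomogeneous hF.pderiv.pderiv c v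

theorem dotProduct_eval_pderiv [Fintype σ] {F : MvPolynomial σ R} {n : ℕ} (hF : F.IsHomogeneous n)
    (v : σ → R) : (v ⬝ᵥ fun i => eval v (pderiv i F)) = n * eval v F := by
  simpa [dotProduct] using congrArg (eval v) hF.sum_X_mul_pderiv

theorem hessian_mulVec_self [Fintype σ] {F : MvPolynomial σ R} {n : ℕ}
    (hF : F.IsHomogeneous (n + 1)) (v : σ → R) :
    (hessian F v).mulVec v = (n : R) • fun i => eval v (pderiv i F) := by
  ext j
  rw [← (hessian_isSymm F v).eq, Matrix.mulVec_transpose]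
  exact dotProduct_eval_pderiv (hF.pderiv (i := j)) v

/-- The restriction of a polynomial to the line through `p` in the direction `v`, in the affine
parameter along the line. -/
noncomputable def restrictLine (p v : σ → R) : MvPolynomial σ R →ₐ[R] Polynomial R :=
  aeval fun i => Polynomial.C (p i) + Polynomial.C (v i) * Polynomial.X

theorem coeff_zero_restrictLine (p v : σ → R) (F : MvPolynomial σ R) :
    (restrictLine p v F).coeff 0 = eval p F := by
  rw [Polynomial.coeff_zero_eq_eval_zero, restrictLine, eval_aeval_polynomial]
  simp

theorem derivative_restrictLine [Fintype σ] (p v : σ → R) (F : MvPolynomial σ R) :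
    Polynomial.derivative (restrictLine p v F) =
      ∑ i, Polynomial.C (v i) * restrictLine p v (pderiv i F) := by
  change Polynomial.derivative' (restrictLine p v F) = _
  rw [restrictLine, derivation_aeval]
  refine Finset.sum_congr rfl fun i _ => ?_
  rw [smul_eq_mul, mul_comm]
  congr 1
  change Polynomial.derivative (_ + _) = _
  rw [Polynomial.derivative_add, Polynomial.derivative_C, zero_add, Polynomial.derivative_C_mul_X]

theorem coeff_one_restrictLine [Fintype σ] (p v : σ → R) (F : MvPolynomial σ R) :
    (restrictLine p v F).coeff 1 = v ⬝ᵥ fun i => eval p (pderiv i F) := by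
  have h := Polynomial.coeff_derivative (restrictLine p v F) 0
  simpa [derivative_restrictLine, Polynomial.finsetSum_coeff, coeff_zero_restrictLine,
    dotProduct] using h.symm

theorem two_mul_coeff_two_restrictLine [Fintype σ] (p v : σ → R) (F : MvPolynomial σ R) :
    2 * (restrictLine p v F).coeff 2 = v ⬝ᵥ (hessian F p).mulVec v := by
  have h := Polynomial.coeff_derivative (restrictLine p v F) 1
  simp only [derivative_restrictLine, Polynomial.finsetSum_coeff, Polynomial.coeff_C_mul,
    coeff_one_restrictLine] at h
  rw [← (hessian_isSymm F p).eq, Matrix.mulVec_transpose]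
  rw [Nat.cast_one, one_add_one_eq_two (R := R)] at h
  exact (mul_comm _ _).trans h.symm

theorem X_pow_three_dvd_restrictLine_iff {k : Type*} [Field k] [NeZero (2 : k)] [Fintype σ]
    (p v : σ → k) (F : MvPolynomial σ k) :
    Polynomial.X ^ 3 ∣ restrictLine p v F ↔ eval p F = 0 ∧
      (v ⬝ᵥ fun i => eval p (pderiv i F)) = 0 ∧ v ⬝ᵥ (hessian F p).mulVec v = 0 := by
  rw [Polynomial.X_pow_dvd_iff, ← coeff_zero_restrictLine p v F, ← coeff_one_restrictLine,
    ← two_mul_coeff_two_restrictLine, mul_eq_zero_iff_left two_ne_zero]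
  refine ⟨fun h => ⟨h 0 (by lia), h 1 (by lia), h 2 (by lia)⟩, ?_⟩
  rintro ⟨h0, h1, h2⟩ d hd
  interval_cases d <;> assumption

end Hessian

section CrossProduct

open scoped Matrix

theorem exists_cross_eq {k : Type*} [Field k] {g v : Fin 3 → k} (hg : g ≠ 0) (h : v ⬝ᵥ g = 0) :
    ∃ e, g ⨯₃ e = v := by
  obtain ⟨i, hi⟩ := Function.ne_iff.1 hg
  refine ⟨(-g i)⁻¹ • Pi.single i 1 ⨯₃ v, ?_⟩
  rw [map_smul, cross_cross_eq_smul_sub_smul', dotProduct_comm g v, h, single_one_dotProduct,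
    zero_smul, zero_sub, ← neg_smul, smul_smul, inv_mul_cancel₀ (neg_ne_zero.2 hi), one_smul]

theorem dotProduct_mulVec_mulVec_cross {R : Type*} [CommRing R]
    {H : Matrix (Fin 3) (Fin 3) R} (hH : H.IsSymm) (p e : Fin 3 → R) :
    (H *ᵥ p) ⨯₃ e ⬝ᵥ H *ᵥ ((H *ᵥ p) ⨯₃ e) =
      (e ⬝ᵥ H.adjugate *ᵥ e) * (p ⬝ᵥ H *ᵥ p) - H.det * (p ⬝ᵥ e) ^ 2 := by
  have h10 := hH.apply 0 1
  have h20 := hH.apply 0 2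
  have h21 := hH.apply 1 2
  simp only [Matrix.det_fin_three, Matrix.adjugate_fin_three, cross_apply, dotProduct,
    Matrix.mulVec, Fin.sum_univ_three, h10, h20, h21, Matrix.cons_val_zero, Matrix.cons_val_one,
    Matrix.cons_val, Matrix.of_apply]
  ring

end CrossProduct

theorem mem_flexes_iff {E : PlaneCurve} (hdeg : E.degree = 3) (hE : E.IsSmooth) (x : Plane) :
    x ∈ E.flexes ↔ eval x.rep E.form = 0 ∧ (hessian E.form x.rep).det = 0 := by
  have hF : E.form.IsHomogeneous (2 + 1) := by simpa [hdeg] using E.form_isHomogeneous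
  set H := hessian E.form x.rep with hH
  have hHx : H.mulVec x.rep = (2 : ℂ) • E.grad x := hessian_mulVec_self hF x.rep
  have hcross (hx : x ∈ E.points) (e : Fin 3 → ℂ) :
      (crossProduct (H.mulVec x.rep) e) ⬝ᵥ H.mulVec (crossProduct (H.mulVec x.rep) e) =
        -(H.det * (x.rep ⬝ᵥ e) ^ 2) := by
    have hxx : x.rep ⬝ᵥ H.mulVec x.rep = 0 := by
      have heuler : x.rep ⬝ᵥ E.grad x = _ := dotProduct_eval_pderiv hF x.rep
      rw [hHx, dotProduct_smul, heuler, PlaneCurve.mem_points.1 hx, mul_zero, smul_zero]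
    rw [dotProduct_mulVec_mulVec_cross (hessian_isSymm _ _), hxx, mul_zero, zero_sub]
  constructor
  · rintro ⟨hx, -, hflex⟩
    refine ⟨hx, ?_⟩
    obtain ⟨i, hi⟩ := Function.ne_iff.1 x.rep_nonzero
    have hperp : E.grad x ⬝ᵥ crossProduct (H.mulVec x.rep) (Pi.single i 1) = 0 := by
      rw [hHx, map_smul, LinearMap.smul_apply, dotProduct_smul, dot_self_cross, smul_zero]
    have hdvd := (X_pow_three_dvd_restrictLine_iff _ _ _).1 (hflex _ hperp)
    rw [← hH, hcross hx] at hdvd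
    simpa [show x.rep i ≠ 0 from hi] using hdvd.2.2
  · rintro ⟨hx, hdet⟩
    refine ⟨hx, hE.grad_ne_zero hx, fun v hv => ?_⟩
    rw [dotProduct_comm] at hv
    obtain ⟨e, rfl⟩ := exists_cross_eq (g := H.mulVec x.rep) (v := v)
      (by rw [hHx]; exact smul_ne_zero two_ne_zero (hE.grad_ne_zero hx))
      (by rw [hHx, dotProduct_smul, hv, smul_zero])
    refine (X_pow_three_dvd_restrictLine_iff _ _ _).2 ⟨hx, hv, ?_⟩
    rw [← hH, hcross hx, hdet, zero_mul, neg_zero]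

theorem exists_mem_flexes {E : PlaneCurve} (hdeg : E.degree = 3) (hE : E.IsSmooth) :
    ∃ x, x ∈ E.flexes := by
  have hF : E.form.IsHomogeneous (1 + 2) := by simpa [hdeg] using E.form_isHomogeneous
  let hess : MvPolynomial (Fin 3) ℂ := (Matrix.of fun i j => pderiv i (pderiv j E.form)).det
  have hhess (v) : eval v hess = (hessian E.form v).det := RingHom.map_det _ _
  obtain ⟨v, hv, hcommon⟩ := exists_ne_zero_forall_eval_eq_zero {E.form, hess}
    (by
      have h0 : hessian E.form 0 = 0 := by simpa using hessian_smul hF 0 0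
      have h1 : eval 0 E.form = 0 := by simpa using eval_smul_of_isHomogeneous hF 0 0
      simp only [Finset.mem_insert, Finset.mem_singleton, forall_eq_or_imp, forall_eq, h1, hhess,
        h0, Matrix.det_zero, and_self])
    (by simpa using Finset.card_le_two.trans_lt (by norm_num : 2 < 3))
  obtain ⟨a, ha⟩ := Projectivization.exists_smul_eq_mk_rep ℂ v hv
  have hvE : eval v E.form = 0 := hcommon _ (by simp)
  have hvH : (hessian E.form v).det = 0 := hhess v ▸ hcommon hess (by simp)
  refine ⟨.mk ℂ v hv, (mem_flexes_iff hdeg hE _).2 ⟨(PlaneCurve.mk_mem_points hv).2 hvE, ?_⟩⟩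
  rw [← ha, Units.smul_def, hessian_smul hF, Matrix.det_smul, hvH, mul_zero]

section LinEquivalent

variable {R σ : Type*} [CommRing R] [Fintype σ] [DecidableEq σ]

/-- Linear equivalence of forms: equality up to an invertible linear change of coordinates. -/
def LinEquivalent (F G : MvPolynomial σ R) : Prop :=
  ∃ N M : Matrix σ σ R, M * N = 1 ∧ F = linSubst N G

namespace LinEquivalent

variable {F G K : MvPolynomial σ R}

theorem symm (h : LinEquivalent F G) : LinEquivalent G F := by
  obtain ⟨N, M, h, rfl⟩ := h
  exact ⟨M, N, mul_eq_one_comm.1 h, by rw [linSubst_linSubst, mul_eq_one_comm.1 h, linSubst_one]⟩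

theorem trans (h : LinEquivalent F G) (h' : LinEquivalent G K) : LinEquivalent F K := by
  obtain ⟨N, M, h, rfl⟩ := h
  obtain ⟨N', M', h', rfl⟩ := h'
  refine ⟨N' * N, M * M', ?_, linSubst_linSubst N' N K⟩
  rw [Matrix.mul_assoc, ← Matrix.mul_assoc M', h', Matrix.one_mul, h]

theorem isNonsingularForm {k : Type*} [Field k] {F G : MvPolynomial σ k} (h : LinEquivalent F G)
    (hF : IsNonsingularForm F) : IsNonsingularForm G := by
  obtain ⟨N, M, hMN, rfl⟩ := h.symm
  exact hF.linSubst hMN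

end LinEquivalent

-- A form that factors through a non-injective linear map is a cone, hence singular at its vertex.
theorem IsNonsingularForm.linEquivalent {k : Type*} [Field k] [Infinite k] {F G : MvPolynomial σ k}
    {n : ℕ} (hF : IsNonsingularForm F) (hG : G.IsHomogeneous (n + 2)) (N : Matrix σ σ k)
    (h : ∀ v, eval v F = eval (N.mulVec v) G) : LinEquivalent F G := by
  obtain rfl : F = _root_.linSubst N G := MvPolynomial.funext fun v => by rw [h, eval_linSubst]
  have hdet : N.det ≠ 0 := by
    rw [Ne, ← Matrix.exists_mulVec_eq_zero_iff]
    rintro ⟨v, hv, hNv⟩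
    have hzero {K : MvPolynomial σ k} {m : ℕ} (hK : K.IsHomogeneous (m + 1)) : eval 0 K = 0 := by
      simpa using eval_smul_of_isHomogeneous hK 0 0
    obtain ⟨j, hj⟩ := hF v hv (by rw [h, hNv, hzero hG])
    refine hj ((congrFun (eval_pderiv_linSubst N G v) j).trans ?_)
    have hgrad : (fun i => eval 0 (pderiv i G)) = 0 := _root_.funext fun i => hzero hG.pderiv
    rw [hNv, hgrad, Matrix.mulVec_zero, Pi.zero_apply]
  exact ⟨N, N⁻¹, Matrix.nonsing_inv_mul N hdet.isUnit, rfl⟩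

end LinEquivalent

section CubeRootOfUnity

theorem exists_sq_add_self_add_one : ∃ w : ℂ, w ^ 2 + w + 1 = 0 := by
  obtain ⟨s, hs⟩ := IsAlgClosed.exists_pow_nat_eq (-3 : ℂ) two_pos
  exact ⟨(-1 + s) / 2, by linear_combination hs / 4⟩

variable {R : Type*} [CommRing R] {w : R}

theorem sum_fourier_pow_three (hw : w ^ 2 + w + 1 = 0) (x y z : R) :
    (x + y + z) ^ 3 + (x + w ^ 2 * y + w * z) ^ 3 + (x + w * y + w ^ 2 * z) ^ 3 =
      3 * (x ^ 3 + y ^ 3 + z ^ 3) + 18 * x * y * z := by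
  linear_combination ((w - 1) * (w ^ 3 + 2) * (y ^ 3 + z ^ 3) + 3 * x ^ 2 * (y + z) +
    3 * (w ^ 2 - w + 1) * x * (y ^ 2 + z ^ 2) + 12 * (w - 1) * x * y * z +
    3 * (w ^ 3 - w + 1) * (y ^ 2 * z + y * z ^ 2)) * hw

theorem prod_fourier (hw : w ^ 2 + w + 1 = 0) (x y z : R) :
    (x + y + z) * (x + w ^ 2 * y + w * z) * (x + w * y + w ^ 2 * z) =
      x ^ 3 + y ^ 3 + z ^ 3 - 3 * x * y * z := by
  linear_combination ((x + y + z) * ((w - 1) * (y ^ 2 + z ^ 2) + x * y + x * z +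
    (w ^ 2 - w + 1) * y * z)) * hw

end CubeRootOfUnity

section NormalForms

/-- The Fermat cubic `x³ + y³ + z³`. -/
noncomputable def fermatForm : MvPolynomial (Fin 3) ℂ := X 0 ^ 3 + X 1 ^ 3 + X 2 ^ 3

/-- The members `x³ + y³ + z³ - 3lxyz` of the Hesse pencil, all of whose smooth members have the
same nine flexes. -/
noncomputable def hesseForm (l : ℂ) : MvPolynomial (Fin 3) ℂ :=
  X 0 ^ 3 + X 1 ^ 3 + X 2 ^ 3 - C (3 * l) * (X 0 * X 1 * X 2)

/-- The cubics `(x + y + z)³ + kxyz`, with three collinear flexes at which the tangents are the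
coordinate lines. -/
noncomputable def trilateralForm (k : ℂ) : MvPolynomial (Fin 3) ℂ :=
  (X 0 + X 1 + X 2) ^ 3 + C k * (X 0 * X 1 * X 2)

/-- The homogeneous Weierstrass cubics `x³ + axz² + bz³ - y²z`. -/
noncomputable def weierstrassForm (a b : ℂ) : MvPolynomial (Fin 3) ℂ :=
  X 0 ^ 3 + C a * (X 0 * X 2 ^ 2) + C b * X 2 ^ 3 - X 1 ^ 2 * X 2

/-- The cubics having the point `(0 : 1 : 0)` and the line `z = 0` as a flex with its tangent. -/
noncomputable def flexForm (c e₁ e₂ e₃ e₄ e₅ e₆ : ℂ) : MvPolynomial (Fin 3) ℂ :=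
  C c * X 0 ^ 3 + X 2 * (C e₁ * X 1 ^ 2 + C e₂ * X 0 * X 1 + C e₃ * X 0 ^ 2 + C e₄ * X 1 * X 2 +
    C e₅ * X 0 * X 2 + C e₆ * X 2 ^ 2)

theorem fermatForm_isHomogeneous : fermatForm.IsHomogeneous 3 :=
  ((isHomogeneous_X_pow 0 3).add (isHomogeneous_X_pow 1 3)).add (isHomogeneous_X_pow 2 3)

theorem isHomogeneous_X_mul_X_mul_X :
    (X 0 * X 1 * X 2 : MvPolynomial (Fin 3) ℂ).IsHomogeneous 3 :=
  ((isHomogeneous_X ℂ 0).mul (isHomogeneous_X ℂ 1)).mul (isHomogeneous_X ℂ 2)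

theorem hesseForm_isHomogeneous (l : ℂ) : (hesseForm l).IsHomogeneous 3 :=
  fermatForm_isHomogeneous.sub (isHomogeneous_X_mul_X_mul_X.C_mul _)

theorem trilateralForm_isHomogeneous (k : ℂ) : (trilateralForm k).IsHomogeneous 3 :=
  ((((isHomogeneous_X ℂ 0).add (isHomogeneous_X ℂ 1)).add (isHomogeneous_X ℂ 2)).pow 3).add
    (isHomogeneous_X_mul_X_mul_X.C_mul _)

theorem weierstrassForm_isHomogeneous (a b : ℂ) : (weierstrassForm a b).IsHomogeneous 3 :=
  have hXZ := ((isHomogeneous_X ℂ (0 : Fin 3)).mul (isHomogeneous_X_pow 2 2)).C_mul a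
  (((isHomogeneous_X_pow 0 3).add hXZ).add ((isHomogeneous_X_pow 2 3).C_mul b)).sub
    ((isHomogeneous_X_pow 1 2).mul (isHomogeneous_X ℂ 2))

theorem hesseForm_linEquivalent_fermatForm {l : ℂ} (hns : IsNonsingularForm (hesseForm l))
    (hl : l ^ 3 = -8) : LinEquivalent (hesseForm l) fermatForm := by
  obtain ⟨w, hw⟩ := exists_sq_add_self_add_one
  obtain ⟨c, hc⟩ := IsAlgClosed.exists_pow_nat_eq (1 / 3 : ℂ) three_pos
  refine hns.linEquivalent fermatForm_isHomogeneous (Matrix.of ![![c, c, -c * l / 2],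
    ![c, c * w ^ 2, -c * w * l / 2], ![c, c * w, -c * w ^ 2 * l / 2]]) fun v => ?_
  simp only [hesseForm, fermatForm, Matrix.mulVec, dotProduct, Fin.sum_univ_three, Matrix.of_apply,
    Matrix.cons_val, map_add, map_sub, map_mul, map_pow, eval_X, eval_C]
  linear_combination (-1 / 3 : ℂ) * sum_fourier_pow_three hw (v 0) (v 1) (-l * v 2 / 2) +
    v 2 ^ 3 / 8 * hl -
    ((v 0 + v 1 + -l * v 2 / 2) ^ 3 + (v 0 + w ^ 2 * v 1 + w * (-l * v 2 / 2)) ^ 3 +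
      (v 0 + w * v 1 + w ^ 2 * (-l * v 2 / 2)) ^ 3) * hc

theorem trilateralForm_linEquivalent_hesseForm {k : ℂ} (hk : k ≠ 0)
    (hns : IsNonsingularForm (trilateralForm k)) :
    ∃ l : ℂ, l ≠ 0 ∧ l ^ 3 ≠ 1 ∧ LinEquivalent (trilateralForm k) (hesseForm l) := by
  have hk27 : 27 + k ≠ 0 := fun h => by
    obtain ⟨i, hi⟩ := hns 1 one_ne_zero (by
      simp only [trilateralForm, map_add, map_mul, map_pow, eval_X, eval_C, Pi.one_apply]
      linear_combination h)
    apply hi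
    fin_cases i <;> simp [trilateralForm, pderiv_X] <;> linear_combination h
  obtain ⟨w, hw⟩ := exists_sq_add_self_add_one
  obtain ⟨r, hr⟩ := IsAlgClosed.exists_pow_nat_eq (27 + k) three_pos
  obtain ⟨t, ht⟩ := IsAlgClosed.exists_pow_nat_eq k three_pos
  have hr0 : r ≠ 0 := by rintro rfl; simp [← hr] at hk27
  have ht0 : t ≠ 0 := by rintro rfl; simp [← ht] at hk
  refine ⟨t / r, div_ne_zero ht0 hr0, ?_, hns.linEquivalent (hesseForm_isHomogeneous _)
    (Matrix.of ![![r / 3, r / 3, r / 3], ![t / 3, t * w ^ 2 / 3, t * w / 3],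
      ![t / 3, t * w / 3, t * w ^ 2 / 3]]) fun v => ?_⟩
  · rw [div_pow, hr, ht, Ne, div_eq_one_iff_eq hk27]
    simp
  · have hlr : t / r * r = t := div_mul_cancel₀ t hr0
    simp only [hesseForm, trilateralForm, Matrix.mulVec, dotProduct, Fin.sum_univ_three,
      Matrix.of_apply, Matrix.cons_val, map_add, map_sub, map_mul, map_pow, eval_X, eval_C]
    generalize t / r = l at hlr
    linear_combination (-(v 0 + v 1 + v 2) ^ 3 / 27) * hr -
      ((v 0 + w ^ 2 * v 1 + w * v 2) ^ 3 + (v 0 + w * v 1 + w ^ 2 * v 2) ^ 3) / 27 * ht -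
      k / 27 * sum_fourier_pow_three hw (v 0) (v 1) (v 2) +
      k / 9 * prod_fourier hw (v 0) (v 1) (v 2) +
      (v 0 + v 1 + v 2) * (v 0 + w ^ 2 * v 1 + w * v 2) * (v 0 + w * v 1 + w ^ 2 * v 2) / 9 *
        (t ^ 2 * hlr + ht)

theorem weierstrassForm_zero_linEquivalent_fermatForm {b : ℂ}
    (hns : IsNonsingularForm (weierstrassForm 0 b)) :
    LinEquivalent (weierstrassForm 0 b) fermatForm := by
  have hb : b ≠ 0 := by
    rintro rfl
    obtain ⟨i, hi⟩ := hns (Pi.single 2 1) (by simp) (by simp [weierstrassForm])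
    apply hi
    fin_cases i <;> simp [weierstrassForm, pderiv_X]
  obtain ⟨p, hp⟩ := IsAlgClosed.exists_pow_nat_eq (b / 2) three_pos
  have hp0 : p ≠ 0 := by rintro rfl; apply hb; linear_combination -2 * hp
  obtain ⟨q, hq⟩ := IsAlgClosed.exists_pow_nat_eq (-1 / (6 * p)) two_pos
  have hpq : 6 * p * q ^ 2 = -1 := by rw [hq]; field_simp
  refine hns.linEquivalent fermatForm_isHomogeneous
    (Matrix.of ![![1, 0, 0], ![0, q, p], ![0, -q, p]]) fun v => ?_
  simp only [weierstrassForm, fermatForm, Matrix.mulVec, dotProduct, Fin.sum_univ_three,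
    Matrix.of_apply, Matrix.cons_val, map_add, map_sub, map_mul, map_pow, eval_X, eval_C]
  linear_combination (-2 * v 2 ^ 3) * hp - v 1 ^ 2 * v 2 * hpq

-- The line `y = rx + s` is the tangent at a flex with `x`-coordinate `c`, that is
-- `x ^ 3 + a * x + b - (r * x + s) ^ 2 = (x - c) ^ 3`; here `c` is a root of the 3-division
-- polynomial of the cubic.
theorem exists_inflectional_tangent_weierstrass {a : ℂ} (ha : a ≠ 0) (b : ℂ) :
    ∃ c r s : ℂ, r ≠ 0 ∧ r ^ 2 = 3 * c ∧ 2 * r * s + 3 * c ^ 2 = a ∧ s ^ 2 - c ^ 3 = b := by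
  obtain ⟨c, hc⟩ : ∃ c : ℂ, 3 * c ^ 4 + 6 * a * c ^ 2 + 12 * b * c - a ^ 2 = 0 := by
    let P : Polynomial ℂ := .C 3 * .X ^ 4 + .C (6 * a) * .X ^ 2 + .C (12 * b) * .X - .C (a ^ 2)
    have hdeg : P.degree = 4 := by simp only [P]; compute_degree!
    obtain ⟨c, hc⟩ := IsAlgClosed.exists_root P (by rw [hdeg]; norm_num)
    exact ⟨c, by simpa [P, Polynomial.IsRoot] using hc⟩
  have hc0 : c ≠ 0 := by rintro rfl; simp [ha] at hc
  obtain ⟨r, hr⟩ := IsAlgClosed.exists_pow_nat_eq (3 * c) two_pos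
  have hr0 : r ≠ 0 := by rintro rfl; simp [hc0] at hr
  refine ⟨c, r, (a - 3 * c ^ 2) / (2 * r), hr0, hr, by field_simp; ring, ?_⟩
  rw [div_pow, mul_pow, hr]
  field_simp
  linear_combination -hc

theorem weierstrassForm_linEquivalent_trilateralForm {a b : ℂ} (ha : a ≠ 0)
    (hns : IsNonsingularForm (weierstrassForm a b)) :
    ∃ k : ℂ, k ≠ 0 ∧ LinEquivalent (weierstrassForm a b) (trilateralForm k) := by
  obtain ⟨c, r, s, hr, hrc, hrs, hsc⟩ := exists_inflectional_tangent_weierstrass ha b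
  obtain ⟨u, hu⟩ : ∃ u, 2 * r * u = 1 := ⟨1 / (2 * r), by field_simp⟩
  have hm : 2 * u * s + c ≠ 0 := fun hm => by
    have hs : s = -(r * c) := by linear_combination r * hm - s * hu
    obtain ⟨i, hi⟩ := hns ![c, 0, 1] (fun h => by simpa using congrFun h 2)
      (by
        simp only [weierstrassForm, map_add, map_sub, map_mul, map_pow, eval_X, eval_C,
          Matrix.cons_val, ← hrs, ← hsc, hs]
        linear_combination -c ^ 2 * hrc)
    apply hi
    fin_cases i <;> simp [weierstrassForm, pderiv_X, ← hrs, ← hsc, hs]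
    · linear_combination -2 * c * hrc
    · linear_combination -c ^ 2 * hrc
  obtain ⟨k, hk⟩ : ∃ k, k * (2 * u * s + c) = 4 * r ^ 2 := ⟨_, div_mul_cancel₀ _ hm⟩
  refine ⟨-k, neg_ne_zero.2 ?_, hns.linEquivalent (trilateralForm_isHomogeneous _)
    (Matrix.of ![![1 / 2, -u, u * s], ![1 / 2, u, u * s], ![0, 0, -(2 * u * s + c)]])
    fun v => ?_⟩
  · rintro rfl
    simp [hr] at hk
  simp only [weierstrassForm, trilateralForm, Matrix.mulVec, dotProduct, Fin.sum_univ_three,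
    Matrix.of_apply, Matrix.cons_val, map_add, map_sub, map_mul, map_neg, map_pow, eval_X, eval_C]
  linear_combination -(v 0 ^ 2 * v 2) * hrc - v 0 * v 2 ^ 2 * hrs - v 2 ^ 3 * hsc -
    v 2 * ((v 0 / 2 + u * s * v 2) ^ 2 - u ^ 2 * v 1 ^ 2) * hk -
    v 2 * (s * v 2 * (2 * r * v 0 + (2 * r * u + 1) * s * v 2) - (2 * r * u + 1) * v 1 ^ 2) * hu

theorem IsNonsingularForm.flexForm_coeffs_ne_zero {c e₁ e₂ e₃ e₄ e₅ e₆ : ℂ}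
    (hns : IsNonsingularForm (flexForm c e₁ e₂ e₃ e₄ e₅ e₆)) : e₁ ≠ 0 ∧ c ≠ 0 := by
  have he : e₁ ≠ 0 := by
    rintro rfl
    obtain ⟨i, hi⟩ := hns (Pi.single 1 1) (by simp) (by simp [flexForm])
    apply hi
    fin_cases i <;> simp [flexForm, pderiv_X]
  refine ⟨he, ?_⟩
  rintro rfl
  obtain ⟨d, hd⟩ := IsAlgClosed.exists_pow_nat_eq (e₂ ^ 2 - 4 * e₁ * e₃) two_pos
  have hy : e₁ * ((-e₂ + d) / (2 * e₁)) ^ 2 + e₂ * ((-e₂ + d) / (2 * e₁)) + e₃ = 0 := by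
    field_simp
    linear_combination hd
  obtain ⟨i, hi⟩ := hns ![1, (-e₂ + d) / (2 * e₁), 0] (fun h => by simpa using congrFun h 0)
    (by simp [flexForm])
  apply hi
  fin_cases i
  · simp [flexForm, pderiv_X]
  · simp [flexForm, pderiv_X]
  · simpa [flexForm, pderiv_X] using hy

theorem flexForm_linEquivalent_weierstrassForm {c e₁ e₂ e₃ e₄ e₅ e₆ : ℂ}
    (hns : IsNonsingularForm (flexForm c e₁ e₂ e₃ e₄ e₅ e₆)) :
    ∃ a b, LinEquivalent (flexForm c e₁ e₂ e₃ e₄ e₅ e₆) (weierstrassForm a b) := by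
  obtain ⟨he, hc⟩ := hns.flexForm_coeffs_ne_zero
  obtain ⟨g, hg⟩ := IsAlgClosed.exists_pow_nat_eq c three_pos
  obtain ⟨d, hd⟩ := IsAlgClosed.exists_pow_nat_eq (-e₁) two_pos
  have hg0 : g ≠ 0 := by rintro rfl; simp [← hg] at hc
  obtain ⟨p, hp⟩ : ∃ p, 2 * e₁ * p = e₂ := ⟨e₂ / (2 * e₁), by field_simp⟩
  obtain ⟨q, hq⟩ : ∃ q, 2 * e₁ * q = e₄ := ⟨e₄ / (2 * e₁), by field_simp⟩
  obtain ⟨s, hs⟩ : ∃ s, 3 * c * s = e₃ - e₁ * p ^ 2 := ⟨(e₃ - e₁ * p ^ 2) / (3 * c), by field_simp⟩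
  obtain ⟨a, ha⟩ : ∃ a, a * g = e₅ - 2 * e₁ * p * q - 3 * c * s ^ 2 :=
    ⟨_, div_mul_cancel₀ _ hg0⟩
  refine ⟨a, e₆ - e₁ * q ^ 2 - c * s ^ 3 - a * g * s, hns.linEquivalent
    (weierstrassForm_isHomogeneous _ _)
    (Matrix.of ![![g, 0, g * s], ![d * p, d, d * q], ![0, 0, 1]]) fun v => ?_⟩
  simp only [flexForm, weierstrassForm, Matrix.mulVec, dotProduct, Fin.sum_univ_three,
    Matrix.of_apply, Matrix.cons_val, map_add, map_sub, map_mul, map_pow, eval_X, eval_C]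
  linear_combination (-(v 0 + s * v 2) ^ 3) * hg + (v 1 + p * v 0 + q * v 2) ^ 2 * v 2 * hd -
    (v 0 * v 2 ^ 2) * ha - (v 0 ^ 2 * v 2) * hs - v 0 * v 1 * v 2 * hp - v 1 * v 2 ^ 2 * hq

section Cubic

variable {R σ : Type*} [CommRing R] {F : MvPolynomial σ R}

theorem eval_pderiv_pderiv_pderiv_of_isHomogeneous_three (hF : F.IsHomogeneous 3) (v : σ → R)
    (i j k : σ) : eval v (pderiv k (pderiv j (pderiv i F))) =
      constantCoeff (pderiv k (pderiv j (pderiv i F))) := by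
  simpa using (eval_smul_of_isHomogeneous hF.pderiv.pderiv.pderiv 0 v).symm

theorem six_mul_eval_of_isHomogeneous_three [Fintype σ] (hF : F.IsHomogeneous 3) (v : σ → R) :
    6 * eval v F = ∑ i, ∑ j, ∑ k,
      v i * v j * v k * constantCoeff (pderiv k (pderiv j (pderiv i F))) := by
  have h (i j : σ) := dotProduct_eval_pderiv ((hF.pderiv (i := i)).pderiv (i := j)) v
  have h1 (i : σ) := dotProduct_eval_pderiv (hF.pderiv (i := i)) v
  have h0 := dotProduct_eval_pderiv hF v
  simp only [dotProduct, eval_pderiv_pderiv_pderiv_of_isHomogeneous_three hF] at h h1 h0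
  simp only [Nat.reduceSub, Nat.cast_one, one_mul, Nat.cast_ofNat] at h h1 h0
  have h6 : 6 * eval v F = 2 * (3 * eval v F) := by ring
  simp only [h6, ← h0, Finset.mul_sum, mul_left_comm (2 : R), ← h1]
  simp only [← h, Finset.mul_sum, mul_assoc]

theorem hessian_single_of_isHomogeneous_three [Finite σ] [DecidableEq σ]
    (hF : F.IsHomogeneous 3) (i j k : σ) :
    hessian F (Pi.single i 1) j k = constantCoeff (pderiv i (pderiv j (pderiv k F))) := by
  have := Fintype.ofFinite σ
  have h := dotProduct_eval_pderiv ((hF.pderiv (i := k)).pderiv (i := j)) (Pi.single i 1)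
  rw [single_one_dotProduct, eval_pderiv_pderiv_pderiv_of_isHomogeneous_three hF] at h
  simpa [hessian] using h.symm

end Cubic

theorem exists_eq_flexForm {F : MvPolynomial (Fin 3) ℂ} (hF : F.IsHomogeneous 3)
    (h00 : hessian F (Pi.single 1 1) 0 0 = 0) (h01 : hessian F (Pi.single 1 1) 0 1 = 0)
    (h11 : hessian F (Pi.single 1 1) 1 1 = 0) :
    ∃ c e₁ e₂ e₃ e₄ e₅ e₆, F = flexForm c e₁ e₂ e₃ e₄ e₅ e₆ := by
  let T (i j k : Fin 3) : ℂ := constantCoeff (pderiv i (pderiv j (pderiv k F)))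
  refine ⟨T 0 0 0 / 6, T 1 1 2 / 2, T 0 1 2, T 0 0 2 / 2, T 1 2 2 / 2, T 0 2 2 / 2, T 2 2 2 / 6,
    MvPolynomial.funext fun v => ?_⟩
  have h := six_mul_eval_of_isHomogeneous_three hF v
  rw [hessian_single_of_isHomogeneous_three hF] at h00 h01 h11
  simp only [Fin.sum_univ_three, pderiv_pderiv_comm (1 : Fin 3) 0,
    pderiv_pderiv_comm (2 : Fin 3) 0, pderiv_pderiv_comm (2 : Fin 3) 1] at h h00 h01 h11
  simp only [flexForm, map_add, map_mul, map_pow, eval_X, eval_C, T]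
  rw [h00, h01, h11] at h
  linear_combination h / 6

theorem exists_flex_frame {k : Type*} [Field k] {g p : Fin 3 → k} (hg : g ≠ 0) (hp : p ≠ 0)
    (hgp : g ⬝ᵥ p = 0) :
    ∃ A : Matrix (Fin 3) (Fin 3) k, A.det ≠ 0 ∧ A.col 1 = p ∧ g ⬝ᵥ A.col 0 = 0 := by
  obtain ⟨f, hf⟩ : ∃ f, f ⬝ᵥ p = 1 := by
    obtain ⟨i, hi⟩ := Function.ne_iff.1 hp
    exact ⟨Pi.single i (p i)⁻¹, by simpa using inv_mul_cancel₀ hi⟩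
  obtain ⟨w, hw⟩ : ∃ w, g ⬝ᵥ w = 1 := by
    obtain ⟨i, hi⟩ := Function.ne_iff.1 hg
    exact ⟨Pi.single i (g i)⁻¹, by simpa using mul_inv_cancel₀ hi⟩
  refine ⟨(Matrix.of ![crossProduct g f, p, w]).transpose, ?_, rfl, dot_self_cross g f⟩
  have hdet : (Matrix.of ![crossProduct g f, p, w]).det = -1 := by
    refine (triple_product_eq_det _ _ _).symm.trans ?_
    rw [cross_dot_cross, hgp, hf, hw]
    ring
  rw [Matrix.det_transpose, hdet]
  exact neg_ne_zero.2 one_ne_zero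

theorem isFermatCubic_of_linEquivalent {E : PlaneCurve} (h : LinEquivalent E.form fermatForm) :
    E.IsFermatCubic := by
  obtain ⟨N, M, hMN, h⟩ := h
  refine ⟨⟨N, M, mul_eq_one_comm.1 hMN, hMN⟩, .of_eq (h.trans ?_)⟩
  simp [linSubst, fermatForm, Matrix.toMvPolynomial, C_mul_X_eq_monomial]

theorem exists_linEquivalent_flexForm {E : PlaneCurve} (hdeg : E.degree = 3) (hE : E.IsSmooth) :
    ∃ c e₁ e₂ e₃ e₄ e₅ e₆, LinEquivalent E.form (flexForm c e₁ e₂ e₃ e₄ e₅ e₆) := by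
  have hF : E.form.IsHomogeneous (2 + 1) := by simpa [hdeg] using E.form_isHomogeneous
  obtain ⟨x, hx, hgrad, hflex⟩ := exists_mem_flexes hdeg hE
  have heuler : x.rep ⬝ᵥ E.grad x = _ := dotProduct_eval_pderiv hF x.rep
  rw [PlaneCurve.mem_points.1 hx, mul_zero, dotProduct_comm] at heuler
  obtain ⟨A, hA, hA1, hA0⟩ := exists_flex_frame hgrad x.rep_nonzero heuler
  have hAx : A.mulVec (Pi.single 1 1) = x.rep := by rw [Matrix.mulVec_single_one, hA1]
  have hhess (i j) : hessian (linSubst A E.form) (Pi.single 1 1) i j =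
      A.col i ⬝ᵥ (hessian E.form x.rep).mulVec (A.col j) := by
    rw [hessian_linSubst, hAx, Matrix.mul_assoc]
    rfl
  have hcol1 (i) : A.col i ⬝ᵥ (hessian E.form x.rep).mulVec (A.col 1) =
      2 * (E.grad x ⬝ᵥ A.col i) := by
    rw [hA1, hessian_mulVec_self hF, dotProduct_comm, smul_dotProduct]
    rfl
  obtain ⟨c, e₁, e₂, e₃, e₄, e₅, e₆, h⟩ := exists_eq_flexForm (linSubst_isHomogeneous A hF)
    ((hhess 0 0).trans ((X_pow_three_dvd_restrictLine_iff _ _ _).1 (hflex _ hA0)).2.2)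
    (by rw [hhess, hcol1, hA0, mul_zero]) (by rw [hhess, hcol1, hA1, heuler, mul_zero])
  exact ⟨c, e₁, e₂, e₃, e₄, e₅, e₆, h ▸
    LinEquivalent.symm ⟨A, A⁻¹, Matrix.nonsing_inv_mul A hA.isUnit, rfl⟩⟩

theorem exists_linEquivalent_hesseForm {E : PlaneCurve} (hdeg : E.degree = 3) (hE : E.IsSmooth)
    (hfermat : ¬ E.IsFermatCubic) :
    ∃ l : ℂ, l ≠ 0 ∧ l ^ 3 ≠ 1 ∧ l ^ 3 ≠ -8 ∧ LinEquivalent E.form (hesseForm l) := by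
  have hns := PlaneCurve.isSmooth_iff.1 hE
  have hnf : ¬ LinEquivalent E.form fermatForm := mt isFermatCubic_of_linEquivalent hfermat
  obtain ⟨c, e₁, e₂, e₃, e₄, e₅, e₆, hflex⟩ := exists_linEquivalent_flexForm hdeg hE
  obtain ⟨a, b, h⟩ := flexForm_linEquivalent_weierstrassForm (hflex.isNonsingularForm hns)
  have hab := hflex.trans h
  have ha : a ≠ 0 := by
    rintro rfl
    exact hnf (hab.trans
      (weierstrassForm_zero_linEquivalent_fermatForm (hab.isNonsingularForm hns)))
  obtain ⟨k, hk, h⟩ :=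
    weierstrassForm_linEquivalent_trilateralForm ha (hab.isNonsingularForm hns)
  have htri := hab.trans h
  obtain ⟨l, hl0, hl1, h⟩ :=
    trilateralForm_linEquivalent_hesseForm hk (htri.isNonsingularForm hns)
  have hl := htri.trans h
  exact ⟨l, hl0, hl1, fun h8 => hnf (hl.trans
    (hesseForm_linEquivalent_fermatForm (hl.isNonsingularForm hns) h8)), hl⟩

end NormalForms

theorem eq_or_eq_add_one_or_eq_add_two : ∀ i j : ZMod 3, j = i ∨ j = i + 1 ∨ j = i + 2 := by
  decide

section AddCharZModThree

theorem zmod_three_three_eq_zero : (3 : ZMod 3) = 0 := rfl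

theorem sum_zmod_three {M : Type*} [AddCommMonoid M] (f : ZMod 3 → M) (i : ZMod 3) :
    ∑ j, f j = f i + f (i + 1) + f (i + 2) := by
  rw [← Equiv.sum_comp (Equiv.addLeft i) f]
  refine (Fin.sum_univ_three fun d : ZMod 3 => f (i + d)).trans ?_
  congr 2
  exact congrArg f (add_zero i)

variable {R : Type*} [CommRing R] (χ : AddChar (ZMod 3) R)

theorem addChar_pow_three (k : ZMod 3) : χ k ^ 3 = 1 := by
  rw [← AddChar.map_nsmul_eq_pow, nsmul_eq_mul, ← AddChar.map_zero_eq_one χ]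
  exact congrArg χ (zero_mul k)

theorem addChar_mul_eq_sq {a b c : ZMod 3} (h : a + b = 2 * c) : χ a * χ b = χ c ^ 2 := by
  rw [← AddChar.map_add_eq_mul, h, two_mul, AddChar.map_add_eq_mul, sq]

theorem addChar_neg (k : ZMod 3) : χ (-k) = χ k ^ 2 := by
  rw [← AddChar.map_nsmul_eq_pow, nsmul_eq_mul]
  exact congrArg χ (by push_cast; linear_combination -k * zmod_three_three_eq_zero)

theorem addChar_add_neg [IsDomain R] (hχ : Function.Injective χ) {m : ZMod 3} (hm : m ≠ 0) :
    χ m + χ (-m) = -1 := by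
  have hne : χ m - 1 ≠ 0 := by
    rw [sub_ne_zero, ← AddChar.map_zero_eq_one χ]
    exact hχ.ne hm
  refine mul_left_cancel₀ hne ?_
  linear_combination (χ m - 1) * addChar_neg χ m + addChar_pow_three χ m

theorem exists_addChar_eq [IsDomain R] (hχ : Function.Injective χ) {z : R} (hz : z ^ 3 = 1) :
    ∃ k, χ k = z := by
  have hsum := addChar_add_neg χ hχ one_ne_zero
  have hprod : χ 1 * χ (-1) = 1 := by
    rw [← AddChar.map_add_eq_mul, add_neg_cancel, AddChar.map_zero_eq_one]
  have h : (z - χ 0) * ((z - χ 1) * (z - χ (-1))) = 0 := by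
    rw [AddChar.map_zero_eq_one]
    linear_combination hz - (z - 1) * z * hsum + (z - 1) * hprod
  simp only [mul_eq_zero, sub_eq_zero] at h
  rcases h with h | h | h
  exacts [⟨0, h.symm⟩, ⟨1, h.symm⟩, ⟨-1, h.symm⟩]

theorem sum_addChar_mul [IsDomain R] (hχ : Function.Injective χ) (m : ZMod 3) :
    ∑ j, χ (m * j) = if m = 0 then 3 else 0 := by
  rw [sum_zmod_three _ 0]
  split_ifs with hm
  · simp only [hm, zero_mul, AddChar.map_zero_eq_one]
    norm_num
  · have h2 : m * (0 + 2) = -m := by linear_combination m * zmod_three_three_eq_zero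
    rw [h2, zero_add, mul_zero, mul_one, AddChar.map_zero_eq_one]
    linear_combination addChar_add_neg χ hχ hm

theorem sum_addChar_quadratic (m b : ZMod 3) (hm : m ≠ 0) :
    ∑ j, χ (m * j ^ 2 + b * j) = χ (-m * b ^ 2) * (1 + 2 * χ m) := by
  have hm2 : m ^ 2 = 1 := ZMod.pow_card_sub_one_eq_one hm
  have h3 := zmod_three_three_eq_zero
  have h0 : m * (b * m) ^ 2 + b * (b * m) = -m * b ^ 2 := by
    linear_combination (m * b ^ 2) * hm2 + b ^ 2 * m * h3
  have h1 : m * (b * m + 1) ^ 2 + b * (b * m + 1) = -m * b ^ 2 + m := by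
    linear_combination (m * b ^ 2 + 2 * b) * hm2 + (b ^ 2 * m + b) * h3
  have h2 : m * (b * m + 2) ^ 2 + b * (b * m + 2) = -m * b ^ 2 + m := by
    linear_combination (m * b ^ 2 + 4 * b) * hm2 + (b ^ 2 * m + 2 * b + m) * h3
  rw [sum_zmod_three _ (b * m), h0, h1, h2, AddChar.map_add_eq_mul]
  ring

end AddCharZModThree

section HesseVectors

/-- The four triangles of the Hesse pencil, indexed by the parallel classes of lines of the affine
plane; the rows are the sides of a triangle. -/
noncomputable def triangleMatrix (χ : AddChar (ZMod 3) ℂ) :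
    Option (ZMod 3) → Matrix (ZMod 3) (ZMod 3) ℂ
  | none => 1
  | some s => Matrix.of fun t j => χ (t * j - s * j ^ 2)

/-- The inverse of `triangleMatrix`, whose columns are the vertices of the triangle. -/
noncomputable def vertexMatrix (χ : AddChar (ZMod 3) ℂ) :
    Option (ZMod 3) → Matrix (ZMod 3) (ZMod 3) ℂ
  | none => 1
  | some s => Matrix.of fun j t => χ (s * j ^ 2 - t * j) / 3

/-- The flexes of all the cubics of the Hesse pencil, where `χ` enumerates the cube roots of
unity. -/
noncomputable def hesseFlex (χ : AddChar (ZMod 3) ℂ) (a : AffPoint) : ZMod 3 → ℂ :=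
  Pi.single (a.1 + 1) 1 - χ a.2 • Pi.single (a.1 + 2) 1

/-- The inflectional tangents of `x³ + y³ + z³ = 3lxyz`, up to a factor. -/
noncomputable def hesseTangent (l : ℂ) (χ : AddChar (ZMod 3) ℂ) (a : AffPoint) : ZMod 3 → ℂ :=
  fun j => χ (a.2 - a.2 * (j - a.1)) * if j = a.1 then l else 1

/-- The value, up to cube roots of unity, of a side of a triangle of the Hesse pencil at the
tangents at the flexes incident with that side. -/
noncomputable def incidentValue (l : ℂ) (χ : AddChar (ZMod 3) ℂ) : Option (ZMod 3) → ℂ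
  | none => l
  | some s => l * χ s + 2

/-- The value, up to cube roots of unity, of a side of a triangle of the Hesse pencil at the
tangents at the other flexes. -/
noncomputable def nonincidentValue (l : ℂ) (χ : AddChar (ZMod 3) ℂ) : Option (ZMod 3) → ℂ
  | none => 1
  | some s => l * χ s - 1

variable {l : ℂ} {χ : AddChar (ZMod 3) ℂ}

theorem triangleMatrix_mul_vertexMatrix (hχ : Function.Injective χ) (c : Option (ZMod 3)) :
    triangleMatrix χ c * vertexMatrix χ c = 1 := by
  rcases c with _ | s
  · exact Matrix.one_mul 1
  · ext t t'
    have hterm (j : ZMod 3) : χ (t * j - s * j ^ 2) * (χ (s * j ^ 2 - t' * j) / 3) =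
        χ ((t - t') * j) / 3 := by
      rw [← mul_div_assoc, ← AddChar.map_add_eq_mul]
      ring_nf
    simp only [triangleMatrix, vertexMatrix, Matrix.mul_apply, Matrix.of_apply, hterm]
    rw [← Finset.sum_div, sum_addChar_mul χ hχ, Matrix.one_apply]
    simp only [sub_eq_zero]
    split_ifs
    exacts [div_self three_ne_zero, zero_div 3]

theorem exists_triangleMatrix_mulVec_vertex_pow_three {c c' : Option (ZMod 3)} (hc : c ≠ c')
    (t' : ZMod 3) :
    ∃ γ ≠ 0, ∀ t, (triangleMatrix χ c).mulVec ((vertexMatrix χ c').col t') t ^ 3 = γ := by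
  rcases c with _ | s <;> rcases c' with _ | s'
  · exact absurd rfl hc
  · refine ⟨1 / 27, by norm_num, fun t => ?_⟩
    rw [triangleMatrix, Matrix.one_mulVec, Matrix.col_apply, vertexMatrix, Matrix.of_apply,
      div_pow, addChar_pow_three]
    norm_num
  · refine ⟨1, one_ne_zero, fun t => ?_⟩
    have hcol : (vertexMatrix χ none).col t' = Pi.single t' 1 :=
      (Matrix.mulVec_single_one _ _).symm.trans (Matrix.one_mulVec _)
    rw [hcol, Matrix.mulVec_single_one]
    exact addChar_pow_three χ _
  · have hm : s' - s ≠ 0 := sub_ne_zero.2 fun h => hc (congrArg some h.symm)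
    refine ⟨((1 + 2 * χ (s' - s)) / 3) ^ 3, ?_, fun t => ?_⟩
    · refine pow_ne_zero 3 (div_ne_zero (fun h => ?_) three_ne_zero)
      have h1 := addChar_pow_three χ (s' - s)
      rw [show χ (s' - s) = -1 / 2 by linear_combination h / 2] at h1
      norm_num at h1
    · have hterm (j : ZMod 3) : χ (t * j - s * j ^ 2) * (χ (s' * j ^ 2 - t' * j) / 3) =
          χ ((s' - s) * j ^ 2 + (t - t') * j) / 3 := by
        rw [← mul_div_assoc, ← AddChar.map_add_eq_mul]
        ring_nf
      simp only [triangleMatrix, vertexMatrix, Matrix.mulVec, dotProduct, Matrix.col_apply,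
        Matrix.of_apply, hterm]
      rw [← Finset.sum_div, sum_addChar_quadratic χ _ _ hm, mul_div_assoc, mul_pow,
        addChar_pow_three, one_mul]

theorem hesseTangent_apply_self (i k : ZMod 3) : hesseTangent l χ (i, k) i = χ k * l := by
  simp [hesseTangent]

theorem hesseTangent_apply_add_one (i k : ZMod 3) : hesseTangent l χ (i, k) (i + 1) = 1 := by
  simp [hesseTangent]

theorem hesseTangent_apply_add_two (i k : ZMod 3) :
    hesseTangent l χ (i, k) (i + 2) = χ (-k) := by
  have h2 : i + 2 ≠ i := by revert i; decide
  simp only [hesseTangent, if_neg h2, mul_one]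
  congr 1
  ring

theorem exists_triangleMatrix_mulVec_hesseTangent (hχ : Function.Injective χ) (a : AffPoint)
    (c : Option (ZMod 3)) : ∃ u v, ∀ t, (triangleMatrix χ c).mulVec (hesseTangent l χ a) t =
      χ (u + v * t) * if Inc a (c, t) then incidentValue l χ c else nonincidentValue l χ c := by
  obtain ⟨i, k⟩ := a
  rcases c with _ | s
  · refine ⟨k + k * i, -k, fun t => ?_⟩
    rw [triangleMatrix, Matrix.one_mulVec, hesseTangent]
    simp only [inc_none, eq_comm (a := t), incidentValue, nonincidentValue]
    congr 2
    ring
  · refine ⟨k - s * i ^ 2 - s, i, fun t => ?_⟩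
    simp only [triangleMatrix, Matrix.mulVec, dotProduct, Matrix.of_apply, incidentValue,
      nonincidentValue]
    rw [sum_zmod_three _ i, hesseTangent_apply_self, hesseTangent_apply_add_one,
      hesseTangent_apply_add_two, mul_one, ← mul_assoc, ← AddChar.map_add_eq_mul,
      ← AddChar.map_add_eq_mul]
    have h3 := zmod_three_three_eq_zero
    obtain ⟨e, rfl⟩ : ∃ e, t = e + k - s * i := ⟨t - k + s * i, by ring⟩
    have hinc : Inc (i, k) (some s, e + k - s * i) ↔ e = 0 := by
      rw [inc_some]
      exact ⟨fun h => by linear_combination -h, fun h => by linear_combination -h⟩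
    set u : ZMod 3 := k - s * i ^ 2 - s + i * (e + k - s * i) with hu
    have e0 : (e + k - s * i) * i - s * i ^ 2 + k = u + s := by
      linear_combination -hu
    have e1 : (e + k - s * i) * (i + 1) - s * (i + 1) ^ 2 = u + e := by
      linear_combination -hu - s * i * h3
    have e2 : (e + k - s * i) * (i + 2) - s * (i + 2) ^ 2 + -k = u - e := by
      linear_combination -hu + (e - s - 2 * s * i) * h3
    rw [e0, e1, e2]
    rcases eq_or_ne e 0 with he | he
    · rw [if_pos (hinc.2 he), he, add_zero, sub_zero, AddChar.map_add_eq_mul]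
      ring
    · rw [if_neg (mt hinc.1 he), sub_eq_add_neg u e]
      simp only [AddChar.map_add_eq_mul]
      linear_combination χ u * addChar_add_neg χ hχ he

theorem hesseFlex_dotProduct (i k : ZMod 3) (v : ZMod 3 → ℂ) :
    hesseFlex χ (i, k) ⬝ᵥ v = v (i + 1) - χ k * v (i + 2) := by
  rw [hesseFlex, sub_dotProduct, smul_dotProduct, single_one_dotProduct, single_one_dotProduct,
    smul_eq_mul]

theorem mul_addChar_ne (hl : l ^ 3 ≠ 1) (j k : ZMod 3) : χ j * l ≠ χ k := fun h =>
  hl (by rw [← addChar_pow_three χ k, ← h, mul_pow, addChar_pow_three, one_mul])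

theorem hesseFlex_dotProduct_hesseTangent (hχ : Function.Injective χ) (hl : l ^ 3 ≠ 1)
    (a b : AffPoint) : hesseFlex χ a ⬝ᵥ hesseTangent l χ b = 0 ↔ a = b := by
  obtain ⟨i, k⟩ := a
  obtain ⟨j, m⟩ := b
  have h3 := zmod_three_three_eq_zero
  have hne : j + 1 ≠ j ∧ j + 2 ≠ j := by revert j; decide
  rw [hesseFlex_dotProduct, sub_eq_zero, Prod.mk.injEq]
  rcases eq_or_eq_add_one_or_eq_add_two j i with rfl | rfl | rfl
  · rw [hesseTangent_apply_add_one, hesseTangent_apply_add_two, ← AddChar.map_add_eq_mul,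
      ← AddChar.map_zero_eq_one χ, hχ.eq_iff, eq_comm, ← sub_eq_add_neg, sub_eq_zero,
      eq_self_iff_true, true_and]
  · rw [show j + 1 + 1 = j + 2 by ring, show j + 1 + 2 = j by linear_combination h3,
      hesseTangent_apply_self, hesseTangent_apply_add_two, ← mul_assoc,
      ← AddChar.map_add_eq_mul]
    exact iff_of_false (mul_addChar_ne hl _ _).symm fun h => hne.1 h.1
  · rw [show j + 2 + 1 = j by linear_combination h3,
      show j + 2 + 2 = j + 1 by linear_combination h3, hesseTangent_apply_self,
      hesseTangent_apply_add_one, mul_one]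
    exact iff_of_false (mul_addChar_ne hl _ _) fun h => hne.2 h.1

theorem hesseFlex_dotProduct_vertex (hχ : Function.Injective χ) (a : AffPoint) (l : AffLine) :
    hesseFlex χ a ⬝ᵥ (vertexMatrix χ l.1).col l.2 = 0 ↔ Inc a l := by
  obtain ⟨i, k⟩ := a
  obtain ⟨_ | s, t⟩ := l
  · have hk : χ k ≠ 0 := fun h => by simpa [h] using addChar_pow_three χ k
    have hsingle : ∀ i t : ZMod 3,
        i ≠ t ∧ i + 1 = t ∧ i + 2 ≠ t ∨ i ≠ t ∧ i + 1 ≠ t ∧ i + 2 = t ∨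
          i = t ∧ i + 1 ≠ t ∧ i + 2 ≠ t := by
      decide
    rw [hesseFlex_dotProduct, inc_none]
    simp only [vertexMatrix, Matrix.col_apply, Matrix.one_apply]
    rcases hsingle i t with ⟨h, h1, h2⟩ | ⟨h, h1, h2⟩ | ⟨h, h1, h2⟩
    · rw [if_pos h1, if_neg h2, mul_zero, sub_zero]
      exact iff_of_false one_ne_zero h
    · rw [if_neg h1, if_pos h2, mul_one, zero_sub, neg_eq_zero]
      exact iff_of_false hk h
    · rw [if_neg h1, if_neg h2, mul_zero, sub_zero]
      exact iff_of_true rfl h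
  · rw [hesseFlex_dotProduct, inc_some]
    simp only [vertexMatrix, Matrix.col_apply, Matrix.of_apply]
    rw [← mul_div_assoc, ← AddChar.map_add_eq_mul, ← sub_div, div_eq_zero_iff, sub_eq_zero,
      hχ.eq_iff, or_iff_left three_ne_zero]
    have h3 := zmod_three_three_eq_zero
    constructor <;> intro h
    · linear_combination -h - s * (i + 1) * h3
    · linear_combination -h - s * (i + 1) * h3

end HesseVectors

section HesseConic

variable {l : ℂ} {χ : AddChar (ZMod 3) ℂ}

theorem incidentValue_ne_zero (h0 : l ≠ 0) (h8 : l ^ 3 ≠ -8) (c : Option (ZMod 3)) :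
    incidentValue l χ c ≠ 0 := by
  rcases c with _ | s
  · exact h0
  · intro h
    have hcube : (l * χ s) ^ 3 = l ^ 3 := by rw [mul_pow, addChar_pow_three, mul_one]
    rw [incidentValue, ← eq_neg_iff_add_eq_zero] at h
    rw [← hcube, h] at h8
    norm_num at h8

theorem nonincidentValue_ne_zero (h1 : l ^ 3 ≠ 1) (c : Option (ZMod 3)) :
    nonincidentValue l χ c ≠ 0 := by
  rcases c with _ | s
  · exact one_ne_zero
  · intro h
    have hcube : (l * χ s) ^ 3 = l ^ 3 := by rw [mul_pow, addChar_pow_three, mul_one]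
    rw [nonincidentValue, sub_eq_zero] at h
    rw [← hcube, h, one_pow] at h1
    exact h1 rfl

theorem incidentValue_pow_three_ne (h1 : l ^ 3 ≠ 1) (c : Option (ZMod 3)) :
    incidentValue l χ c ^ 3 ≠ nonincidentValue l χ c ^ 3 := by
  rcases c with _ | s
  · rwa [incidentValue, nonincidentValue, one_pow]
  · intro h
    have hcube : (l * χ s) ^ 3 = l ^ 3 := by rw [mul_pow, addChar_pow_three, mul_one]
    rw [incidentValue, nonincidentValue] at h
    refine h1 (hcube.symm.trans ?_)
    linear_combination (l * χ s - 1) / 9 * h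

/-- The weight of the third side of a triangle, which makes the conic of a Hesse configuration the
conic `y₁ y₂ = y₀²` of `hesseFrame`. -/
noncomputable def frameWeight (l : ℂ) (χ : AddChar (ZMod 3) ℂ) (c : Option (ZMod 3)) (d : ZMod 3) :
    ℂ :=
  if d = 2 then nonincidentValue l χ c / incidentValue l χ c else 1

/-- Coordinates in which the conic of a Hesse configuration indexed by `m` is `y₁ y₂ = y₀²`. -/
noncomputable def hesseFrame (l : ℂ) (χ : AddChar (ZMod 3) ℂ) (m : AffLine) :
    Matrix (ZMod 3) (ZMod 3) ℂ :=
  Matrix.diagonal (frameWeight l χ m.1) *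
    (triangleMatrix χ m.1).submatrix (Equiv.addLeft m.2) (Equiv.refl _)

/-- The inverse of `hesseFrame`. -/
noncomputable def hesseCoframe (l : ℂ) (χ : AddChar (ZMod 3) ℂ) (m : AffLine) :
    Matrix (ZMod 3) (ZMod 3) ℂ :=
  (vertexMatrix χ m.1).submatrix (Equiv.refl _) (Equiv.addLeft m.2) *
    Matrix.diagonal (frameWeight l χ m.1)⁻¹

theorem hesseCoframe_mul_hesseFrame (hχ : Function.Injective χ) (h0 : l ≠ 0) (h1 : l ^ 3 ≠ 1)
    (h8 : l ^ 3 ≠ -8) (m : AffLine) : hesseCoframe l χ m * hesseFrame l χ m = 1 := by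
  have hweight (d : ZMod 3) : frameWeight l χ m.1 d ≠ 0 := by
    rw [frameWeight]
    split_ifs
    exacts [div_ne_zero (nonincidentValue_ne_zero h1 _) (incidentValue_ne_zero h0 h8 _),
      one_ne_zero]
  have hdiag : Matrix.diagonal (frameWeight l χ m.1)⁻¹ *
      Matrix.diagonal (frameWeight l χ m.1) = 1 := by
    rw [Matrix.diagonal_mul_diagonal, ← Matrix.diagonal_one]
    exact congrArg Matrix.diagonal (funext fun d => inv_mul_cancel₀ (hweight d))
  rw [hesseCoframe, hesseFrame, Matrix.mul_assoc, ← Matrix.mul_assoc (Matrix.diagonal _), hdiag,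
    Matrix.one_mul, Matrix.submatrix_mul_equiv,
    mul_eq_one_comm.1 (triangleMatrix_mul_vertexMatrix hχ m.1), Matrix.submatrix_one_equiv]

theorem hesseFrame_mulVec (c : Option (ZMod 3)) (t d : ZMod 3) (v : ZMod 3 → ℂ) :
    (hesseFrame l χ (c, t)).mulVec v d =
      frameWeight l χ c d * (triangleMatrix χ c).mulVec v (t + d) := by
  rw [hesseFrame, ← Matrix.mulVec_mulVec, Matrix.mulVec_diagonal]
  rfl

/-- The vector `v` lies on the conic of a Hesse configuration indexed by `m`. -/
def OnHesseConic (l : ℂ) (χ : AddChar (ZMod 3) ℂ) (m : AffLine) (v : ZMod 3 → ℂ) : Prop :=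
  (hesseFrame l χ m).mulVec v 1 * (hesseFrame l χ m).mulVec v 2 = (hesseFrame l χ m).mulVec v 0 ^ 2

theorem onHesseConic_iff (h0 : l ≠ 0) (h8 : l ^ 3 ≠ -8) (c : Option (ZMod 3)) (t : ZMod 3)
    (v : ZMod 3 → ℂ) : OnHesseConic l χ (c, t) v ↔
      nonincidentValue l χ c * ((triangleMatrix χ c).mulVec v (t + 1) *
        (triangleMatrix χ c).mulVec v (t + 2)) =
      incidentValue l χ c * (triangleMatrix χ c).mulVec v t ^ 2 := by
  have hα := incidentValue_ne_zero (χ := χ) h0 h8 c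
  have h12 : (1 : ZMod 3) ≠ 2 := by decide
  have h02 : (0 : ZMod 3) ≠ 2 := by decide
  simp only [OnHesseConic, hesseFrame_mulVec, frameWeight, if_neg h12, if_neg h02, if_true,
    add_zero, one_mul]
  field_simp

theorem inc_trichotomy : ∀ (a : AffPoint) (c : Option (ZMod 3)) (t : ZMod 3),
    Inc a (c, t) ∧ ¬ Inc a (c, t + 1) ∧ ¬ Inc a (c, t + 2) ∨
    ¬ Inc a (c, t) ∧ Inc a (c, t + 1) ∧ ¬ Inc a (c, t + 2) ∨
    ¬ Inc a (c, t) ∧ ¬ Inc a (c, t + 1) ∧ Inc a (c, t + 2) := by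
  decide

theorem onHesseConic_hesseTangent (hχ : Function.Injective χ) (h0 : l ≠ 0) (h1 : l ^ 3 ≠ 1)
    (h8 : l ^ 3 ≠ -8) (a : AffPoint) (m : AffLine) :
    OnHesseConic l χ m (hesseTangent l χ a) ↔ ¬ Inc a m := by
  obtain ⟨c, t⟩ := m
  obtain ⟨u, v, hval⟩ := exists_triangleMatrix_mulVec_hesseTangent (l := l) hχ a c
  have hphase : χ (u + v * (t + 1)) * χ (u + v * (t + 2)) = χ (u + v * t) ^ 2 :=
    addChar_mul_eq_sq χ (by linear_combination v * zmod_three_three_eq_zero)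
  have hχt : χ (u + v * t) ^ 2 ≠ 0 := pow_ne_zero 2 fun h => by
    simpa [h] using addChar_pow_three χ (u + v * t)
  rw [onHesseConic_iff h0 h8, hval, hval, hval, mul_mul_mul_comm, hphase, mul_pow,
    mul_left_comm, mul_left_comm (incidentValue l χ c), mul_right_inj' hχt]
  rcases inc_trichotomy a c t with ⟨h, h', h''⟩ | ⟨h, h', h''⟩ | ⟨h, h', h''⟩
  · rw [if_pos h, if_neg h', if_neg h'']
    exact iff_of_false
      (fun heq => incidentValue_pow_three_ne h1 c (by linear_combination -heq)) (not_not_intro h)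
  · rw [if_neg h, if_pos h', if_neg h'']
    exact iff_of_true (by ring) h
  · rw [if_neg h, if_neg h', if_pos h'']
    exact iff_of_true (by ring) h

theorem onHesseConic_vertex (hχ : Function.Injective χ) (h0 : l ≠ 0) (h1 : l ^ 3 ≠ 1)
    (h8 : l ^ 3 ≠ -8) (m m' : AffLine) :
    OnHesseConic l χ m ((vertexMatrix χ m'.1).col m'.2) ↔ m'.1 = m.1 ∧ m' ≠ m := by
  obtain ⟨c, t⟩ := m
  obtain ⟨c', t'⟩ := m'
  rw [onHesseConic_iff h0 h8]
  rcases eq_or_ne c c' with rfl | hc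
  · have hval (j : ZMod 3) : (triangleMatrix χ c).mulVec ((vertexMatrix χ c).col t') j =
        if j = t' then 1 else 0 := by
      rw [← Matrix.one_apply, ← triangleMatrix_mul_vertexMatrix hχ c]
      rfl
    have hne : ∀ t t' : ZMod 3, ¬ (t + 1 = t' ∧ t + 2 = t') := by decide
    have hprod : (if t + 1 = t' then (1 : ℂ) else 0) * (if t + 2 = t' then 1 else 0) = 0 := by
      rw [ite_zero_mul_ite_zero, if_neg (hne t t')]
    simp only [hval, hprod, mul_zero, zero_eq_mul, incidentValue_ne_zero h0 h8 c, false_or,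
      true_and, ne_eq, Prod.mk.injEq, pow_eq_zero_iff two_ne_zero, ite_eq_right_iff, one_ne_zero,
      imp_false, eq_comm (a := t)]
  · obtain ⟨γ, hγ, hcube⟩ := exists_triangleMatrix_mulVec_vertex_pow_three (χ := χ) hc t'
    refine iff_of_false (fun h => incidentValue_pow_three_ne (χ := χ) h1 c ?_)
      fun h => hc h.1.symm
    have h3 := congrArg (· ^ 3) h
    simp only [mul_pow, hcube, ← pow_mul, mul_comm 2 3] at h3
    rw [pow_mul, hcube, ← sq] at h3
    exact (mul_right_cancel₀ (pow_ne_zero 2 hγ) h3).symm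

end HesseConic

section HesseFlexes

variable {l : ℂ} {χ : AddChar (ZMod 3) ℂ}

theorem eval_hesseForm (l : ℂ) (v : Fin 3 → ℂ) :
    eval v (hesseForm l) = ∑ j, v j ^ 3 - 3 * l * ∏ j, v j := by
  simp [hesseForm, Fin.sum_univ_three, Fin.prod_univ_three]

theorem pderiv_hesseForm (l : ℂ) (j : Fin 3) :
    pderiv j (hesseForm l) = C 3 * (X j ^ 2 - C l * (X (j + 1) * X (j + 2))) := by
  have h3 : (3 : MvPolynomial (Fin 3) ℂ) = C 3 := (map_ofNat C 3).symm
  fin_cases j <;> simp [hesseForm, pderiv_X, h3] <;> ring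

theorem hessian_hesseForm (l : ℂ) (v : Fin 3 → ℂ) : hessian (hesseForm l) v =
    !![6 * v 0, -3 * l * v 2, -3 * l * v 1;
      -3 * l * v 2, 6 * v 1, -3 * l * v 0;
      -3 * l * v 1, -3 * l * v 0, 6 * v 2] := by
  ext i j
  fin_cases i <;> fin_cases j <;> simp [hessian, pderiv_hesseForm, pderiv_X] <;> ring

theorem det_hessian_hesseForm (l : ℂ) (v : Fin 3 → ℂ) : (hessian (hesseForm l) v).det =
    216 * (1 - l ^ 3) * ∏ j, v j - 54 * l ^ 2 * eval v (hesseForm l) := by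
  rw [hessian_hesseForm, Matrix.det_fin_three, eval_hesseForm, Fin.sum_univ_three,
    Fin.prod_univ_three]
  simp only [Matrix.of_apply, Matrix.cons_val]
  ring

theorem hesseFlex_apply_self (i k : ZMod 3) : hesseFlex χ (i, k) i = 0 := by
  have h : i ≠ i + 1 ∧ i ≠ i + 2 := by revert i; decide
  simp [hesseFlex, h.1, h.2]

theorem hesseFlex_apply_add_one (i k : ZMod 3) : hesseFlex χ (i, k) (i + 1) = 1 := by
  have h : i + 1 ≠ i + 2 := by revert i; decide
  simp [hesseFlex, h]

theorem hesseFlex_apply_add_two (i k : ZMod 3) : hesseFlex χ (i, k) (i + 2) = -χ k := by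
  have h : i + 2 ≠ i + 1 := by revert i; decide
  simp [hesseFlex, h]

theorem eq_smul_hesseFlex_iff (hχ : Function.Injective χ) {v : ZMod 3 → ℂ} (hv : v ≠ 0) :
    ∑ j, v j ^ 3 = 0 ∧ ∏ j, v j = 0 ↔ ∃ a, ∃ c : ℂ, v = c • hesseFlex χ a := by
  constructor
  · rintro ⟨hsum, hprod⟩
    obtain ⟨i, -, hi⟩ := Finset.prod_eq_zero_iff.1 hprod
    rw [sum_zmod_three _ i, hi, zero_pow three_ne_zero, zero_add] at hsum
    have hne : v (i + 1) ≠ 0 := fun h => hv <| funext fun j => by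
      rw [h, zero_pow three_ne_zero, zero_add, pow_eq_zero_iff three_ne_zero] at hsum
      rcases eq_or_eq_add_one_or_eq_add_two i j with rfl | rfl | rfl
      exacts [hi, h, hsum]
    obtain ⟨k, hk⟩ := exists_addChar_eq χ hχ (z := -v (i + 2) / v (i + 1)) (by
      rw [div_pow, div_eq_one_iff_eq (pow_ne_zero 3 hne)]
      linear_combination -hsum)
    refine ⟨(i, k), v (i + 1), funext fun j => ?_⟩
    rw [Pi.smul_apply, smul_eq_mul]
    rcases eq_or_eq_add_one_or_eq_add_two i j with rfl | rfl | rfl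
    · rw [hesseFlex_apply_self, hi, mul_zero]
    · rw [hesseFlex_apply_add_one, mul_one]
    · rw [hesseFlex_apply_add_two, hk]
      field_simp
  · rintro ⟨⟨i, k⟩, c, rfl⟩
    have hi : (c • hesseFlex χ (i, k)) i = 0 := by
      rw [Pi.smul_apply, hesseFlex_apply_self, smul_zero]
    refine ⟨?_, Finset.prod_eq_zero (Finset.mem_univ i) hi⟩
    rw [sum_zmod_three _ i, hi, Pi.smul_apply, Pi.smul_apply, hesseFlex_apply_add_one,
      hesseFlex_apply_add_two, smul_eq_mul, smul_eq_mul]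
    linear_combination -c ^ 3 * addChar_pow_three χ k

theorem eval_pderiv_hesseForm (l : ℂ) (v : Fin 3 → ℂ) (j : Fin 3) :
    eval v (pderiv j (hesseForm l)) = 3 * (v j ^ 2 - l * (v (j + 1) * v (j + 2))) := by
  rw [pderiv_hesseForm]
  simp only [map_mul, map_sub, map_pow, eval_C, eval_X]

theorem eval_pderiv_hesseForm_hesseFlex (a : AffPoint) :
    (fun j => eval (hesseFlex χ a) (pderiv j (hesseForm l))) = (3 : ℂ) • hesseTangent l χ a := by
  obtain ⟨i, k⟩ := a
  have h3 := zmod_three_three_eq_zero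
  refine funext fun j : ZMod 3 => (eval_pderiv_hesseForm l (hesseFlex χ (i, k)) j).trans ?_
  change 3 * (hesseFlex χ (i, k) j ^ 2 -
    l * (hesseFlex χ (i, k) (j + 1) * hesseFlex χ (i, k) (j + 2))) = 3 * _
  congr 1
  rcases eq_or_eq_add_one_or_eq_add_two i j with rfl | rfl | rfl
  · rw [hesseFlex_apply_self, hesseFlex_apply_add_one, hesseFlex_apply_add_two,
      hesseTangent_apply_self]
    ring
  · rw [show i + 1 + 1 = i + 2 by ring, show i + 1 + 2 = i by linear_combination h3,
      hesseFlex_apply_self, hesseFlex_apply_add_one, hesseTangent_apply_add_one]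
    ring
  · rw [show i + 2 + 1 = i by linear_combination h3,
      show i + 2 + 2 = i + 1 by linear_combination h3, hesseFlex_apply_self,
      hesseFlex_apply_add_two, hesseTangent_apply_add_two, addChar_neg]
    ring

end HesseFlexes

theorem mulVec_dotProduct_transpose_mulVec {ι R : Type*} [Fintype ι] [DecidableEq ι] [CommRing R]
    {M N : Matrix ι ι R} (h : M * N = 1) (v w : ι → R) :
    M.mulVec v ⬝ᵥ N.transpose.mulVec w = v ⬝ᵥ w := by
  rw [Matrix.dotProduct_mulVec, Matrix.vecMul_transpose, Matrix.mulVec_mulVec,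
    mul_eq_one_comm.1 h, Matrix.one_mulVec]

theorem eq_mk_iff_exists_rep_eq_smul {k V : Type*} [Field k] [AddCommGroup V] [Module k V]
    {x : ℙ k V} {v : V} {hv : v ≠ 0} :
    x = Projectivization.mk k v hv ↔ ∃ c : k, x.rep = c • v := by
  conv_lhs => rw [← x.mk_rep]
  rw [Projectivization.mk_eq_mk_iff']
  simp only [eq_comm]

/-- Coordinates for a Hesse configuration: `point` for the cusps and nodes, `flex` for the
coefficients of the lines, and the conics as `y₁ y₂ = y₀²` in the coordinates `frame`. -/
structure HesseCoordinates where
  flex : AffPoint → Fin 3 → ℂ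
  point : AffPoint ⊕ AffLine → Fin 3 → ℂ
  frame : AffLine → Matrix (Fin 3) (Fin 3) ℂ
  coframe : AffLine → Matrix (Fin 3) (Fin 3) ℂ
  coframe_mul_frame : ∀ m, coframe m * frame m = 1
  flex_ne_zero : ∀ a, flex a ≠ 0
  point_ne_zero : ∀ x, point x ≠ 0
  flex_dotProduct_point : ∀ a x, flex a ⬝ᵥ point x = 0 ↔ OnLine x a
  frame_mulVec_point : ∀ m x, (frame m).mulVec (point x) 1 * (frame m).mulVec (point x) 2 =
    (frame m).mulVec (point x) 0 ^ 2 ↔ OnConic x m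

namespace HesseCoordinates

variable (K : HesseCoordinates) {N M : Matrix (Fin 3) (Fin 3) ℂ} (hMN : M * N = 1)

/-- Linear change of coordinates: the flexes are points of the primal plane, and everything else
lives in the dual plane, hence is transformed contragrediently. -/
def map : HesseCoordinates where
  flex a := M.mulVec (K.flex a)
  point x := N.transpose.mulVec (K.point x)
  frame m := K.frame m * M.transpose
  coframe m := N.transpose * K.coframe m
  coframe_mul_frame m := by
    rw [Matrix.mul_assoc, ← Matrix.mul_assoc _ _ M.transpose, K.coframe_mul_frame,
      Matrix.one_mul, transpose_mul_transpose_eq_one (mul_eq_one_comm.1 hMN)]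
  flex_ne_zero a := mulVec_ne_zero_of_mul_eq_one (mul_eq_one_comm.1 hMN) (K.flex_ne_zero a)
  point_ne_zero x :=
    mulVec_ne_zero_of_mul_eq_one (transpose_mul_transpose_eq_one hMN) (K.point_ne_zero x)
  flex_dotProduct_point a x := by
    rw [mulVec_dotProduct_transpose_mulVec hMN, K.flex_dotProduct_point]
  frame_mulVec_point m x := by
    rw [← Matrix.mulVec_mulVec, Matrix.mulVec_mulVec _ M.transpose,
      transpose_mul_transpose_eq_one hMN, Matrix.one_mulVec, K.frame_mulVec_point]

/-- The Hesse configuration with given coordinates. -/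
noncomputable def configuration : HesseConfiguration where
  point x := Projectivization.mk ℂ (K.point x) (K.point_ne_zero x)
  line a := PlaneCurve.dualLine (Projectivization.mk ℂ (K.flex a) (K.flex_ne_zero a))
  conic m := PlaneCurve.conicOfFrame (K.frame m) (K.coframe m) (K.coframe_mul_frame m)
  degree_line _ := PlaneCurve.degree_dualLine _
  degree_conic _ := PlaneCurve.degree_conicOfFrame _
  hasParametrization_line _ := PlaneCurve.hasParametrization_dualLine _
  hasParametrization_conic _ := PlaneCurve.hasParametrization_conicOfFrame _
  isSmooth_line _ := PlaneCurve.isSmooth_dualLine _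
  isSmooth_conic _ := PlaneCurve.isSmooth_conicOfFrame _
  mem_line x a := by
    rw [PlaneCurve.mk_mem_points_dualLine_mk, K.flex_dotProduct_point]
  mem_conic x m := by
    rw [PlaneCurve.mk_mem_points_conicOfFrame, K.frame_mulVec_point]

/-- The vectors `flex a` represent the flexes of the curve with equation `F`, and `point (.inl a)`
the tangents there. -/
structure IsAdapted (F : MvPolynomial (Fin 3) ℂ) : Prop where
  flex_iff : ∀ v, v ≠ 0 → (eval v F = 0 ∧ (hessian F v).det = 0 ↔ ∃ a, ∃ c : ℂ, v = c • K.flex a)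
  exists_grad : ∀ a, ∃ c : ℂ, (fun i => eval (K.flex a) (pderiv i F)) = c • K.point (.inl a)

variable {K}

theorem IsAdapted.map {F : MvPolynomial (Fin 3) ℂ} (h : K.IsAdapted F) :
    (K.map hMN).IsAdapted (linSubst N F) where
  flex_iff v hv := by
    have hdet : N.det ≠ 0 := fun h => by simpa [h] using congrArg Matrix.det hMN
    have hsolve (w : Fin 3 → ℂ) : N.mulVec v = w ↔ v = M.mulVec w := by
      constructor <;> rintro rfl
      · rw [Matrix.mulVec_mulVec, hMN, Matrix.one_mulVec]
      · rw [Matrix.mulVec_mulVec, mul_eq_one_comm.1 hMN, Matrix.one_mulVec]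
    rw [eval_linSubst, hessian_linSubst, Matrix.det_mul, Matrix.det_mul, Matrix.det_transpose,
      mul_eq_zero_iff_right hdet, mul_eq_zero_iff_left hdet,
      h.flex_iff _ (mulVec_ne_zero_of_mul_eq_one hMN hv)]
    simp only [hsolve, Matrix.mulVec_smul, HesseCoordinates.map]
  exists_grad a := by
    obtain ⟨c, hc⟩ := h.exists_grad a
    refine ⟨c, ?_⟩
    change _ = c • N.transpose.mulVec (K.point (.inl a))
    rw [← Matrix.mulVec_smul, ← hc]
    refine (eval_pderiv_linSubst N F (M.mulVec (K.flex a))).trans ?_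
    rw [Matrix.mulVec_mulVec, mul_eq_one_comm.1 hMN, Matrix.one_mulVec]

section Cubic

variable {E : PlaneCurve} (hdeg : E.degree = 3) (hE : E.IsSmooth) (h : K.IsAdapted E.form)
include hdeg h

theorem IsAdapted.exists_grad_mk (a : AffPoint) : ∃ c : ℂ,
    E.grad (Projectivization.mk ℂ (K.flex a) (K.flex_ne_zero a)) = c • K.point (.inl a) := by
  have hF : E.form.IsHomogeneous 3 := by simpa only [hdeg] using E.form_isHomogeneous
  obtain ⟨c, hc⟩ := eq_mk_iff_exists_rep_eq_smul.1 (rfl (a := Projectivization.mk ℂ (K.flex a) _))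
  obtain ⟨d, hd⟩ := h.exists_grad a
  refine ⟨c ^ 2 * d, ?_⟩
  rw [mul_smul, ← hd]
  ext i
  rw [PlaneCurve.grad, hc]
  exact eval_smul_of_isHomogeneous (hF.pderiv (i := i)) c (K.flex a)

include hE

theorem IsAdapted.flexes_eq : E.flexes =
    Set.range fun a => Projectivization.mk ℂ (K.flex a) (K.flex_ne_zero a) := by
  ext x
  rw [mem_flexes_iff hdeg hE, h.flex_iff _ x.rep_nonzero]
  simp only [Set.mem_range, eq_comm (b := x), eq_mk_iff_exists_rep_eq_smul]

theorem IsAdapted.dualHesseLines_eq : dualHesseLines E = Set.range K.configuration.line := by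
  rw [dualHesseLines_eq_image, h.flexes_eq hdeg hE, ← Set.range_comp]
  rfl

theorem IsAdapted.dualCusps_eq : dualCusps E = Set.range K.configuration.cusp := by
  ext q
  rw [dualCusps, h.flexes_eq hdeg hE, Set.mem_ofPred_eq, Set.exists_range_iff]
  refine exists_congr fun a => ?_
  have hmk (hgrad : E.grad (Projectivization.mk ℂ (K.flex a) (K.flex_ne_zero a)) ≠ 0) :
      Projectivization.mk ℂ _ hgrad = K.configuration.cusp a :=
    (Projectivization.mk_eq_mk_iff' ..).2 <| (h.exists_grad_mk hdeg a).imp fun _ => Eq.symm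
  constructor
  · rintro ⟨hgrad, rfl⟩
    exact (hmk hgrad).symm
  · rintro rfl
    have hflex : Projectivization.mk ℂ (K.flex a) (K.flex_ne_zero a) ∈ E.flexes :=
      h.flexes_eq hdeg hE ▸ Set.mem_range_self a
    exact ⟨hflex.2.1, (hmk hflex.2.1).symm⟩

end Cubic

end HesseCoordinates

section HessePencil

variable {l : ℂ} {χ : AddChar (ZMod 3) ℂ}

theorem hesseFlex_ne_zero (a : AffPoint) : hesseFlex χ a ≠ 0 := fun h => by
  simpa [h] using hesseFlex_apply_add_one (χ := χ) a.1 a.2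

theorem hesseTangent_ne_zero (a : AffPoint) : hesseTangent l χ a ≠ 0 := fun h => by
  simpa [h] using hesseTangent_apply_add_one (l := l) (χ := χ) a.1 a.2

theorem vertexMatrix_col_ne_zero (hχ : Function.Injective χ) (m : AffLine) :
    (vertexMatrix χ m.1).col m.2 ≠ 0 := fun h => by
  have hone : (triangleMatrix χ m.1).mulVec ((vertexMatrix χ m.1).col m.2) m.2 = 1 :=
    (congrFun₂ (triangleMatrix_mul_vertexMatrix hχ m.1) m.2 m.2).trans (Matrix.one_apply_eq _)
  simp [h] at hone

/-- The coordinates of the Hesse configuration of the cubic `hesseForm l`. -/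
noncomputable def hesseCoordinates (hχ : Function.Injective χ) (h0 : l ≠ 0) (h1 : l ^ 3 ≠ 1)
    (h8 : l ^ 3 ≠ -8) : HesseCoordinates where
  flex := hesseFlex χ
  point := Sum.elim (hesseTangent l χ) fun m => (vertexMatrix χ m.1).col m.2
  frame := hesseFrame l χ
  coframe := hesseCoframe l χ
  coframe_mul_frame := hesseCoframe_mul_hesseFrame hχ h0 h1 h8
  flex_ne_zero := hesseFlex_ne_zero
  point_ne_zero := Sum.rec hesseTangent_ne_zero (vertexMatrix_col_ne_zero hχ)
  flex_dotProduct_point a := Sum.rec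
    (fun b => (hesseFlex_dotProduct_hesseTangent hχ h1 a b).trans eq_comm)
    (hesseFlex_dotProduct_vertex hχ a)
  frame_mulVec_point m := Sum.rec (fun a => onHesseConic_hesseTangent hχ h0 h1 h8 a m)
    (onHesseConic_vertex hχ h0 h1 h8 m)

theorem isAdapted_hesseCoordinates (hχ : Function.Injective χ) (h0 : l ≠ 0) (h1 : l ^ 3 ≠ 1)
    (h8 : l ^ 3 ≠ -8) : (hesseCoordinates hχ h0 h1 h8).IsAdapted (hesseForm l) where
  flex_iff v hv := by
    refine Iff.trans ?_ (eq_smul_hesseFlex_iff hχ hv)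
    change _ ↔ ∑ j : Fin 3, v j ^ 3 = 0 ∧ ∏ j : Fin 3, v j = 0
    rw [det_hessian_hesseForm]
    have hne : 216 * (1 - l ^ 3) ≠ 0 := mul_ne_zero (by norm_num) (sub_ne_zero.2 h1.symm)
    constructor
    · rintro ⟨heval, hdet⟩
      rw [heval, mul_zero, sub_zero, mul_eq_zero_iff_left hne] at hdet
      rw [eval_hesseForm, hdet, mul_zero, sub_zero] at heval
      exact ⟨heval, hdet⟩
    · rintro ⟨hsum, hprod⟩
      rw [eval_hesseForm, hsum, hprod]
      simp only [mul_zero, sub_zero, and_self]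
  exists_grad a := ⟨3, eval_pderiv_hesseForm_hesseFlex a⟩

end HessePencil

theorem exists_hesseConfiguration {E : PlaneCurve} (hdeg : E.degree = 3) (hE : E.IsSmooth)
    (hfermat : ¬ E.IsFermatCubic) : ∃ H : HesseConfiguration,
      dualCusps E = Set.range H.cusp ∧ dualHesseLines E = Set.range H.line := by
  obtain ⟨l, h0, h1, h8, N, M, hMN, hform⟩ := exists_linEquivalent_hesseForm hdeg hE hfermat
  have h := (isAdapted_hesseCoordinates ZMod.injective_stdAddChar h0 h1 h8).map hMN
  rw [← hform] at h
  exact ⟨_, h.dualCusps_eq hdeg hE, h.dualHesseLines_eq hdeg hE⟩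

theorem HesseConfiguration.hesseConics_eq (H : HesseConfiguration) {E : PlaneCurve}
    (h : dualCusps E = Set.range H.cusp) : hesseConics E = Set.range H.conic := by
  ext C
  rw [hesseConics, Set.mem_ofPred_eq, h]
  refine ⟨fun ⟨hdeg, _, hC⟩ => H.conic_eq_of_ncard_inter hdeg hC, ?_⟩
  rintro ⟨m, rfl⟩
  exact ⟨H.degree_conic m, (H.hasParametrization_conic m).isIntegral, H.ncard_cusps_inter_conic m⟩

theorem mainTheorem4 (E : PlaneCurve) (hdeg : E.degree = 3) (hsmooth : E.IsSmooth)
    (hE : ¬ E.IsFermatCubic) :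
    -- the arrangement of twelve conics
    (hesseConics E).ncard = 12 ∧
    Arrangement.IsDArrangement 2 (hesseConics E) ∧
    -- its singular locus
    (dualCusps E).ncard = 9 ∧
    (∀ p ∈ dualCusps E, Arrangement.mult (hesseConics E) p = 8) ∧
    (Arrangement.nodes (hesseConics E)).ncard = 12 ∧
    Arrangement.sing (hesseConics E) = dualCusps E ∪ Arrangement.nodes (hesseConics E) ∧
    (Arrangement.sing (hesseConics E)).ncard = 21 ∧
    (∀ C ∈ hesseConics E, (dualCusps E ∩ C.points).ncard = 6 ∧
      (Arrangement.nodes (hesseConics E) ∩ C.points).ncard = 2) ∧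
    -- the nine lines of the dual Hesse arrangement
    (dualHesseLines E).ncard = 9 ∧
    Arrangement.sing (dualHesseLines E) = Arrangement.nodes (hesseConics E) ∧
    (∀ p ∈ Arrangement.sing (dualHesseLines E), Arrangement.mult (dualHesseLines E) p = 3) ∧
    (∀ L ∈ dualHesseLines E, (Arrangement.nodes (hesseConics E) ∩ L.points).ncard = 4 ∧
      (dualCusps E ∩ L.points).ncard = 1) ∧
    -- the reducible quintic through all singular points
    (∃ L₁ ∈ dualHesseLines E, ∃ L₂ ∈ dualHesseLines E, ∃ L₃ ∈ dualHesseLines E,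
      ∃ C ∈ hesseConics E, L₁ ≠ L₂ ∧ L₁ ≠ L₃ ∧ L₂ ≠ L₃ ∧
      ∃ Q : PlaneCurve, Q.degree = 5 ∧
        Associated Q.form (L₁.form * L₂.form * L₃.form * C.form) ∧
        Arrangement.sing (hesseConics E) ⊆ Q.points) ∧
    -- the configurational Seshadri constant, and the ratios of the conics and of the lines
    Arrangement.configurationalSeshadri (hesseConics E) = 1 / 4 ∧
    (∀ C ∈ hesseConics E, C.seshadriRatio (Arrangement.sing (hesseConics E)) = 1 / 4) ∧
    (∀ L ∈ dualHesseLines E, L.IsIntegral ∧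
      L.seshadriRatio (Arrangement.sing (hesseConics E)) = 1 / 5) ∧
    -- the multipoint Seshadri constant
    seshadriConstant (Arrangement.sing (hesseConics E)) = 1 / 5 ∧
    seshadriConstant (Arrangement.sing (hesseConics E)) <
      Arrangement.configurationalSeshadri (hesseConics E) := by
  obtain ⟨H, hcusps, hlines⟩ := exists_hesseConfiguration hdeg hsmooth hE
  rw [H.hesseConics_eq hcusps, hcusps, hlines, H.sing_conics, H.nodes_conics, H.sing_lines]
  refine ⟨H.ncard_range_conic, H.isDArrangement, H.ncard_range_cusp,
    Set.forall_mem_range.2 H.mult_conics_cusp, H.ncard_range_node, H.range_point,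
    H.ncard_range_point,
    Set.forall_mem_range.2 fun l => ⟨H.ncard_cusps_inter_conic l, H.ncard_nodes_inter_conic l⟩,
    H.ncard_range_line, rfl, Set.forall_mem_range.2 H.mult_lines_node,
    Set.forall_mem_range.2 fun a => ⟨H.ncard_nodes_inter_line a, H.ncard_cusps_inter_line a⟩,
    ?quintic, H.configurationalSeshadri_conics, Set.forall_mem_range.2 H.seshadriRatio_conic,
    Set.forall_mem_range.2 fun a =>
      ⟨(H.hasParametrization_line a).isIntegral, H.seshadriRatio_line a⟩,
    H.seshadriConstant_eq, ?lt⟩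
  case quintic =>
    exact ⟨_, ⟨(0, 0), rfl⟩, _, ⟨(0, 1), rfl⟩, _, ⟨(0, 2), rfl⟩, _, ⟨(none, 0), rfl⟩,
      H.line_injective.ne (by decide), H.line_injective.ne (by decide),
      H.line_injective.ne (by decide), H.exists_quintic⟩
  case lt =>
    rw [H.seshadriConstant_eq, H.configurationalSeshadri_conics]
    norm_num
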